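/- Let $X_t = u + ct + \sigma W_t - S_t$ ($t \ge 0$), where $u,\sigma \ge 0$, $c>0$, $W$ is a Wiener process and $S$ is a pure-jump subordinator independent of $W$, with $\mathbb{E}[e^{i\lambda S_t}] = \exp\big(t\int_{(0,\infty)} (e^{i\lambda z}-1)\,\nu(dz)\big)$, $\nu((-\infty,0])=0$, $\int (1\wedge z)\,\nu(dz)<\infty$, $\int z^2\,\nu(dz)<\infty$ and $c>\mathbb{E}[S_1]$. Let $P$ be the law of $X$ on the space $\mathbb{D}_\infty$ of real càdlàg functions on $[0,\infty)$. Fix $r>0$ and $\bar\vartheta>u$. For $x\in\mathbb{D}_\infty$ and $\vartheta\ge u$ put $\xi^\vartheta_0(x)=0$, $\xi^\vartheta_t(x) = (\sup_{0\le s<t}x_s-\vartheta)\vee 0$ for $t>0$, and $\tau^\vartheta(x)=\inf\{t>0 : x_t-\xi^\vartheta_t(x)<0\}$. For $h_n>0$, $t_k=kh_n$, $\Delta_k x = x_{t_k}-x_{t_{k-1}}$ and a permutation $i$ of $\{1,\dots,n\}$, the quasi-process is $\hat x^{i,n}_t = u+\sum_{k=1}^n \Delta_{i(k)}x\,\mathbf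 1_{[t_k,\infty)}(t)$. With $\mathrm{id}$ the identity permutation, define $$h_n^\vartheta(x) = \int_{[0,\tau_n^\vartheta(x))} e^{-rt}\,d\xi^\vartheta_t(\hat x^{\mathrm{id},n}),\qquad \tau_n^\vartheta(x)=\tau^\vartheta(\hat x^{\mathrm{id},n})\wedge t_n .$$ For each $n$ let $i_{(1)},\dots,i_{(\alpha_n)}$ ($\alpha_n\ge 1$) be independent, uniformly distributed permutations of $\{1,\dots,n\}$, jointly independent of $X$, and let $\mathbb{P}_{\alpha_n}=\alpha_n^{-1}\sum_{k=1}^{\alpha_n}\delta_{\hat X^{i_{(k)},n}}$. If $h_n\to 0$, $nh_n\to\infty$ and $n/\alpha_n\to 0$ as $n\to\infty$, then each $h_n^\vartheta$ with $\vartheta\in[u,\bar\vartheta]$ is $P$-integrable and $$\sup_{\vartheta\in[u,\bar\vartheta]}\big|(\mathbb{P}_{\alpha_n}-P)h_n^\vartheta\big| \xrightarrow{\ p\ } 0 .$$ -/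

import Mathlib

open MeasureTheory ProbabilityTheory Filter Topology
open scoped NNReal ENNReal

noncomputable section

namespace DividendBarrier

/-- Right-continuity on `[0, ∞)` together with existence of all left limits. -/
structure IsCadlag (f : ℝ≥0 → ℝ) : Prop where
  right_cont : ∀ t, ContinuousWithinAt f (Set.Ici t) t
  left_lim : ∀ t, ∃ l, Tendsto f (𝓝[<] t) (𝓝 l)

/-- The path space `D[0, ∞)` of real càdlàg functions. -/
structure CadlagPath where
  toFun : ℝ≥0 → ℝ
  isCadlag : IsCadlag toFun

instance : CoeFun CadlagPath (fun _ => ℝ≥0 → ℝ) := ⟨CadlagPath.toFun⟩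

/-- The σ-algebra on the path space generated by the evaluations `x ↦ x t`; it is the Borel
σ-algebra of the Skorokhod topology. -/
instance : MeasurableSpace CadlagPath := MeasurableSpace.comap CadlagPath.toFun MeasurableSpace.pi

/-- The discrete σ-algebra on the (finite) set of permutations of `n` points. -/
instance (n : ℕ) : MeasurableSpace (Equiv.Perm (Fin n)) := ⊤

/-! ### Càdlàg functions: auxiliary facts -/

lemma isCadlag_const (b : ℝ) : IsCadlag (fun _ => b) :=
  ⟨fun _ => continuousWithinAt_const, fun _ => ⟨b, tendsto_const_nhds⟩⟩

lemma isCadlag_step (a : ℝ≥0) (b : ℝ) :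
    IsCadlag (fun t => b * (Set.Ici a).indicator (fun _ => (1 : ℝ)) t) := by
  refine ⟨fun t => ?_, fun t => ?_⟩
  · by_cases h : a ≤ t
    · have e : ∀ s ∈ Set.Ici t, b * (Set.Ici a).indicator (fun _ => (1 : ℝ)) s = b := by
        intro s hs
        have : s ∈ Set.Ici a := h.trans hs
        simp [Set.indicator_of_mem this]
      exact (continuousWithinAt_const (b := b)).congr e (e t Set.self_mem_Ici)
    · have h' : t < a := not_le.1 h
      refine ContinuousAt.continuousWithinAt ?_
      refine (continuousAt_const (y := (0 : ℝ))).congr ?_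
      filter_upwards [Iio_mem_nhds h'] with s hs
      have : s ∉ Set.Ici a := fun h2 => absurd (show s < a from hs) (not_lt.2 h2)
      simp [Set.indicator_of_notMem this]
  · by_cases h : a < t
    · refine ⟨b, tendsto_const_nhds.congr' ?_⟩
      filter_upwards [mem_nhdsWithin_of_mem_nhds (Ioi_mem_nhds h)] with s hs
      have : s ∈ Set.Ici a := le_of_lt (show a < s from hs)
      simp [Set.indicator_of_mem this]
    · refine ⟨0, tendsto_const_nhds.congr' ?_⟩
      filter_upwards [self_mem_nhdsWithin] with s hs
      have : s ∉ Set.Ici a := not_le.2 (lt_of_lt_of_le hs (not_lt.1 h))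
      simp [Set.indicator_of_notMem this]

lemma IsCadlag.add {f g : ℝ≥0 → ℝ} (hf : IsCadlag f) (hg : IsCadlag g) :
    IsCadlag (fun t => f t + g t) := by
  refine ⟨fun t => (hf.right_cont t).add (hg.right_cont t), fun t => ?_⟩
  obtain ⟨l, hl⟩ := hf.left_lim t
  obtain ⟨m, hm⟩ := hg.left_lim t
  exact ⟨l + m, hl.add hm⟩

lemma isCadlag_sum {ι : Type*} (s : Finset ι) (f : ι → ℝ≥0 → ℝ) (hf : ∀ i, IsCadlag (f i)) :
    IsCadlag (fun t => ∑ i ∈ s, f i t) := by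
  refine ⟨fun t => ?_, fun t => ?_⟩
  · exact tendsto_finsetSum s fun i _ => (hf i).right_cont t
  · choose l hl using fun i => (hf i).left_lim t
    exact ⟨∑ i ∈ s, l i, tendsto_finsetSum s fun i _ => hl i⟩

/-- A càdlàg function is bounded above on bounded time intervals. -/
lemma IsCadlag.bddAbove {f : ℝ≥0 → ℝ} (hf : IsCadlag f) (t : ℝ) :
    BddAbove (f '' {s : ℝ≥0 | (s : ℝ) < t}) := by
  have key : BddAbove (f '' Set.Icc 0 t.toNNReal) := by
    refine isCompact_Icc.induction_on (p := fun A => BddAbove (f '' A)) ?_ ?_ ?_ ?_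
    · simp
    · exact fun A B hAB hB => hB.mono (Set.image_mono hAB)
    · intro A B hA hB
      rw [Set.image_union]
      exact hA.union hB
    · intro x _
      obtain ⟨l, hl⟩ := hf.left_lim x
      have h1 : ∀ᶠ y in 𝓝[<] x, f y < l + 1 := hl.eventually (gt_mem_nhds (by linarith))
      have h2 : ∀ᶠ y in 𝓝[≥] x, f y < f x + 1 :=
        (hf.right_cont x).eventually (gt_mem_nhds (by linarith))
      have h3 : ∀ᶠ y in 𝓝 x, f y < max (l + 1) (f x + 1) := by
        rw [← nhdsLT_sup_nhdsGE, eventually_sup]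
        exact ⟨h1.mono fun y hy => lt_max_of_lt_left hy, h2.mono fun y hy => lt_max_of_lt_right hy⟩
      refine ⟨_, mem_nhdsWithin_of_mem_nhds h3, ⟨max (l + 1) (f x + 1), ?_⟩⟩
      rintro _ ⟨y, hy, rfl⟩
      exact le_of_lt hy
  refine key.mono (Set.image_mono fun s (hs : (s : ℝ) < t) => Set.mem_Icc.2 ⟨zero_le, ?_⟩)
  exact NNReal.le_toNNReal_of_coe_le hs.le

/-! ### Dividends and ruin -/

/-- The running supremum `x̄_t = sup_{0 ≤ s < t} x_s`. -/
def runningSup (x : CadlagPath) (t : ℝ) : ℝ := sSup (x '' {s : ℝ≥0 | (s : ℝ) < t})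

/-- Cumulative dividends at barrier `ϑ`: `ξ_t = (x̄_t - ϑ) ∨ 0` for `t > 0` and `ξ_0 = 0`,
extended by `0` to negative times. -/
def dividend (ϑ : ℝ) (x : CadlagPath) (t : ℝ) : ℝ :=
  if 0 < t then max (runningSup x t - ϑ) 0 else 0

lemma dividend_mono (ϑ : ℝ) (x : CadlagPath) : Monotone (dividend ϑ x) := by
  intro s t hst
  unfold dividend
  by_cases hs : 0 < s
  · have ht : 0 < t := hs.trans_le hst
    rw [if_pos hs, if_pos ht]
    refine max_le_max (sub_le_sub_right ?_ ϑ) le_rfl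
    refine csSup_le_csSup (x.isCadlag.bddAbove t) ⟨x 0, 0, by simpa using hs, rfl⟩ ?_
    exact Set.image_mono fun r hr => lt_of_lt_of_le hr hst
  · rw [if_neg hs]
    split_ifs
    · exact le_max_right _ _
    · exact le_rfl

/-- The Lebesgue–Stieltjes measure `dξ` of the non-decreasing, left-continuous function `ξ`,
so that `dξ [a, b) = ξ_b - ξ_a`. -/
def dividendMeasure (ϑ : ℝ) (x : CadlagPath) : Measure ℝ :=
  (dividend_mono ϑ x).stieltjesFunction.measure

/-- The ruin time `inf {t > 0 | x_t - ξ_t < 0}` of the controlled path, `∞` if there is no ruin. -/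
def ruinTime (ϑ : ℝ) (x : CadlagPath) : ℝ≥0∞ :=
  sInf ((fun t : ℝ≥0 => (t : ℝ≥0∞)) '' {t : ℝ≥0 | 0 < t ∧ x t - dividend ϑ x t < 0})

/-- The present value `∫_{[0, τ)} e^{-rt} dξ_t` of the dividends paid before the time `τ`. -/
def presentValue (r ϑ : ℝ) (τ : ℝ≥0∞) (x : CadlagPath) : ℝ :=
  ∫ t in {t : ℝ | 0 ≤ t ∧ ENNReal.ofReal t < τ}, Real.exp (-(r * t)) ∂(dividendMeasure ϑ x)

/-! ### Quasi-processes -/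

/-- The increment `x_{t_{k+1}} - x_{t_k}` over the grid `t_k = k h` (with `k` counted from `0`). -/
def increment (h : ℝ≥0) (x : CadlagPath) (k : ℕ) : ℝ := x ((k + 1) * h) - x (k * h)

/-- The quasi-process `t ↦ u + ∑_{k=1}^n Δ_{π(k)} x · 1_{[t_k, ∞)}(t)`. -/
def quasiPath (u : ℝ) (h : ℝ≥0) (n : ℕ) (π : Equiv.Perm (Fin n)) (x : CadlagPath) :
    CadlagPath where
  toFun t := u + ∑ k : Fin n,
    increment h x (π k) * (Set.Ici (((k : ℕ) + 1 : ℝ≥0) * h)).indicator (fun _ => (1 : ℝ)) t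
  isCadlag := (isCadlag_const u).add (isCadlag_sum _ _ fun _ => isCadlag_step _ _)

/-- The discretized functional `h_n^ϑ`: the present value of the dividends on the quasi-process with
the identity permutation, up to its ruin time, which is set to `t_n = n h` if there is no ruin
up to `t_n`. -/
def discreteValue (r u : ℝ) (h : ℝ≥0) (n : ℕ) (ϑ : ℝ) (x : CadlagPath) : ℝ :=
  presentValue r ϑ (min (ruinTime ϑ (quasiPath u h n 1 x)) ((n * h : ℝ≥0) : ℝ≥0∞))
    (quasiPath u h n 1 x)

/-- The empirical measure `a⁻¹ ∑_{k=1}^a δ_{x̂^k}` of the quasi-processes of the path `x` for the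
permutations `π 1, …, π a`. -/
def empiricalMeasure (u : ℝ) (h : ℝ≥0) (n a : ℕ) (π : Fin a → Equiv.Perm (Fin n))
    (x : CadlagPath) : Measure CadlagPath :=
  (a : ℝ≥0∞)⁻¹ • ∑ k : Fin a, Measure.dirac (quasiPath u h n (π k) x)

/-! ### The probabilistic model -/

/-- Real Lévy processes started at `0`. -/
structure IsLevyProcess {Ω : Type*} [MeasurableSpace Ω] (μ : Measure Ω) (S : ℝ≥0 → Ω → ℝ) :
    Prop where
  measurable : ∀ t, Measurable (S t)
  zero : ∀ᵐ ω ∂μ, S 0 ω = 0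
  indep_increments : HasIndepIncrements S μ
  stationary_increments : ∀ s t, IdentDistrib (fun ω => S (s + t) ω - S s ω) (S t) μ μ
  cadlag : ∀ᵐ ω ∂μ, IsCadlag (fun t => S t ω)

/-- Pure-jump subordinators with Lévy measure `ν`: Lévy processes with non-decreasing paths and
`E[exp (iλ S_t)] = exp (t ∫ (exp (iλz) - 1) ν(dz))`, where `ν` is carried by `(0, ∞)` and
`∫ (1 ∧ z) ν(dz) < ∞`. -/
structure IsPureJumpSubordinator {Ω : Type*} [MeasurableSpace Ω] (μ : Measure Ω)
    (S : ℝ≥0 → Ω → ℝ) (ν : Measure ℝ) : Prop where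
  isLevyProcess : IsLevyProcess μ S
  mono : ∀ᵐ ω ∂μ, Monotone (fun t => S t ω)
  levyMeasure_Iic : ν (Set.Iic 0) = 0
  levyMeasure_finite : ∫⁻ z, ENNReal.ofReal (min 1 z) ∂ν < ∞
  charFun_eq : ∀ (t : ℝ≥0) (l : ℝ), charFun (μ.map (S t)) l =
    Complex.exp (t * ∫ z, (Complex.exp (l * z * Complex.I) - 1) ∂ν)

/-- The insurance risk process `X_t = u + c t + σ W_t - S_t`: `W` is a Wiener process, `S` is a
pure-jump subordinator independent of `W` with square integrable jumps, and the net profit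
condition `c > E[S_1]` holds. -/
structure IsRiskProcess {Ω : Type*} [MeasurableSpace Ω] (μ : Measure Ω) (u c σ : ℝ)
    (W S : ℝ≥0 → Ω → ℝ) (ν : Measure ℝ) (X : Ω → CadlagPath) : Prop where
  initial_nonneg : 0 ≤ u
  premium_pos : 0 < c
  vol_nonneg : 0 ≤ σ
  measurable_W : ∀ t, Measurable (W t)
  wiener : IsBrownianReal W μ
  subordinator : IsPureJumpSubordinator μ S ν
  indep : IndepFun (fun ω t => W t ω) (fun ω t => S t ω) μ
  levyMeasure_sq : ∫⁻ z, ENNReal.ofReal (z ^ 2) ∂ν < ∞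
  net_profit : ∫ ω, S 1 ω ∂μ < c
  measurable : Measurable X
  eq : ∀ᵐ ω ∂μ, ∀ t : ℝ≥0, X ω t = u + c * t + σ * W t ω - S t ω

/-- `π 1, …, π a` are independent, uniformly distributed permutations of `n` points, jointly
independent of the process `X`. -/
structure IsUniformSample {Ω : Type*} [MeasurableSpace Ω] (μ : Measure Ω) (X : Ω → CadlagPath)
    {n a : ℕ} (π : Fin a → Ω → Equiv.Perm (Fin n)) : Prop where
  measurable : ∀ k, Measurable (π k)
  uniform : ∀ k p, μ {ω | π k ω = p} = (n.factorial : ℝ≥0∞)⁻¹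
  iIndep : iIndepFun π μ
  indep : IndepFun X (fun ω k => π k ω) μ

end DividendBarrier

end

open DividendBarrier

noncomputable section

namespace DividendBarrier

/-! On a grid the quasi-process is a step path, so its discounted dividends are a functional
`walkValue` of the vector of increments alone (`discreteValue_eq`), and permuting the quasi-process
permutes that vector (`increments_quasiPath`). The increments of the risk process are i.i.d.
(`IsRiskProcess.exists_map_increments`), so all permuted vectors have the same law. What remains is
a law of large numbers, uniform in the barrier, for averages over random permutations. Three
estimates carry it.

Truncation: dividends paid after step `m` are at most `discountedRise`, the discounted growth of the
running maximum, whatever the barrier. Dropping the claims only raises the running maximum, so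
Doob's inequality for the Brownian part bounds the second moment by a constant times `exp (-r m h)`,
uniformly in the mesh (`IsRiskProcess.exists_discountedRise_bound`).

Variance: a centred function of `m` of `n` i.i.d. coordinates, averaged over all permutations, has
second moment at most `1 / ⌊n/m⌋` times its own, by Hoeffding's decomposition into independent
blocks (`integral_sum_perm_sq_le`). Sampling `a` permutations adds `1 / a`
(`integral_permMean_sq_le`).

Uniformity: value plus barrier is non-decreasing in the barrier (`walkValue_add_mono`), so `N`
brackets of mean size `O(1/N)` cover the whole family (`exists_brackets`).

`exists_uniform_bound` combines these. With `m = ⌈√(n/h)⌉` both `m h` and `n / m` tend to infinity;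
`N` is fixed first, then `n` grows, and Markov's inequality finishes. -/

/-! ### Random walk functionals -/

/-- The walk `u + z_0 + ⋯ + z_{k-1}`. -/
def walk (u : ℝ) (z : ℕ → ℝ) (k : ℕ) : ℝ := u + ∑ i ∈ Finset.range k, z i

/-- The running maximum of the walk. -/
def peak (u : ℝ) (z : ℕ → ℝ) (k : ℕ) : ℝ := partialSups (walk u z) k

/-- The amount by which the running maximum exceeds the barrier. -/
def excess (u ϑ : ℝ) (z : ℕ → ℝ) (k : ℕ) : ℝ := max (peak u z k - ϑ) 0

/-- The controlled walk is not ruined up to step `k`. -/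
def Solvent (u ϑ : ℝ) (z : ℕ → ℝ) (k : ℕ) : Prop := ∀ j < k, excess u ϑ z j ≤ walk u z (j + 1)

open Classical in
/-- The discounted dividends of the first `m` steps of the walk, paid until ruin. -/
def walkValue (β u : ℝ) (m : ℕ) (ϑ : ℝ) (z : ℕ → ℝ) : ℝ :=
  ∑ k ∈ Finset.range m, if Solvent u ϑ z (k + 1) then
    β ^ (k + 1) * (excess u ϑ z (k + 1) - excess u ϑ z k) else 0

lemma walk_zero (u : ℝ) (z : ℕ → ℝ) : walk u z 0 = u := by simp [walk]

lemma walk_succ (u : ℝ) (z : ℕ → ℝ) (k : ℕ) : walk u z (k + 1) = walk u z k + z k := by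
  simp [walk, Finset.sum_range_succ, add_assoc]

lemma peak_zero (u : ℝ) (z : ℕ → ℝ) : peak u z 0 = u := by simp [peak, walk_zero]

lemma peak_succ (u : ℝ) (z : ℕ → ℝ) (k : ℕ) :
    peak u z (k + 1) = max (peak u z k) (walk u z (k + 1)) := by
  simp [peak, partialSups_add_one]

lemma peak_mono (u : ℝ) (z : ℕ → ℝ) : Monotone (peak u z) := (partialSups (walk u z)).monotone

lemma le_peak (u : ℝ) (z : ℕ → ℝ) (k : ℕ) : u ≤ peak u z k := by
  simpa [peak_zero] using peak_mono u z (Nat.zero_le k)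

lemma excess_zero {u ϑ : ℝ} (hϑ : u ≤ ϑ) (z : ℕ → ℝ) : excess u ϑ z 0 = 0 := by
  simp [excess, peak_zero, hϑ]

lemma excess_mono (u ϑ : ℝ) (z : ℕ → ℝ) : Monotone (excess u ϑ z) := fun _ _ hij =>
  max_le_max (sub_le_sub_right (peak_mono u z hij) ϑ) le_rfl

/-- Paying out at a new maximum cannot cause ruin: what is left is at least `min ϑ (walk)`, and both
are at least `u ≥ 0`. Hence ruin need only be tested before the payout. -/
lemma excess_succ_le_walk {u ϑ : ℝ} (hu : 0 ≤ u) (hϑ : u ≤ ϑ) {z : ℕ → ℝ} {j : ℕ}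
    (h : excess u ϑ z j ≤ walk u z (j + 1)) : excess u ϑ z (j + 1) ≤ walk u z (j + 1) := by
  rcases le_total (walk u z (j + 1)) (peak u z j) with h1 | h1
  · have : excess u ϑ z (j + 1) = excess u ϑ z j := by
      simp [excess, peak_succ, max_eq_left h1]
    rwa [this]
  · have h2 := le_peak u z j
    refine max_le ?_ (hu.trans (h2.trans h1))
    rw [peak_succ, max_eq_right h1]
    linarith

/-! ### Step paths -/

section StepPath

variable {u ϑ h : ℝ} {z : ℕ → ℝ} {x : CadlagPath}

/-- The supremum runs over `s < t` strictly, so it sees exactly the walk indices `j` with `j h < t`.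
-/
lemma runningSup_step (hh : 0 < h) (hx : ∀ t : ℝ≥0, x t = walk u z ⌊(t : ℝ) / h⌋₊)
    {t : ℝ} (ht : 0 < t) : runningSup x t = peak u z (⌈t / h⌉₊ - 1) := by
  have hpos : 0 < ⌈t / h⌉₊ := Nat.ceil_pos.2 (div_pos ht hh)
  have hub : ∀ b ∈ x '' {s : ℝ≥0 | (s : ℝ) < t}, b ≤ peak u z (⌈t / h⌉₊ - 1) := by
    rintro _ ⟨s, hs, rfl⟩
    rw [hx]
    refine le_partialSups_of_le _ (Nat.le_sub_one_of_lt ?_)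
    have h1 : (⌊(s : ℝ) / h⌋₊ : ℝ) ≤ s / h := Nat.floor_le (div_nonneg s.2 hh.le)
    have h2 : (s : ℝ) / h < t / h := div_lt_div_of_pos_right hs hh
    exact_mod_cast (h1.trans_lt h2).trans_le (Nat.le_ceil _)
  apply le_antisymm
  · exact csSup_le ⟨x 0, 0, by simpa using ht, rfl⟩ hub
  · obtain ⟨j, hj, he⟩ := exists_partialSups_eq (walk u z) (⌈t / h⌉₊ - 1)
    rw [peak, he]
    refine le_csSup ⟨_, hub⟩ ⟨(j * h).toNNReal, ?_, ?_⟩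
    · have h1 : (j : ℝ) < t / h := Nat.lt_ceil.1 (by omega)
      rw [lt_div_iff₀ hh] at h1
      simpa [Real.coe_toNNReal _ (by positivity : 0 ≤ (j : ℝ) * h)] using h1
    · rw [hx, Real.coe_toNNReal _ (by positivity : 0 ≤ (j : ℝ) * h), mul_div_assoc,
        div_self hh.ne', mul_one, Nat.floor_natCast]

lemma dividend_step (hϑ : u ≤ ϑ) (hh : 0 < h)
    (hx : ∀ t : ℝ≥0, x t = walk u z ⌊(t : ℝ) / h⌋₊) (t : ℝ) :
    dividend ϑ x t = excess u ϑ z (⌈t / h⌉₊ - 1) := by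
  unfold dividend
  split_ifs with ht
  · rw [runningSup_step hh hx ht, excess]
  -- Truncated subtraction gives `0 - 1 = 0`, and the excess at step `0` vanishes because `u ≤ ϑ`.
  · have : ⌈t / h⌉₊ = 0 := Nat.ceil_eq_zero.2 (div_nonpos_of_nonpos_of_nonneg (not_lt.1 ht) hh.le)
    rw [this, excess_zero hϑ]

/-- Passing to right limits replaces the left-continuous index `⌈t/h⌉ - 1` by the right-continuous
`⌊t/h⌋`. -/
lemma stieltjes_step (hϑ : u ≤ ϑ) (hh : 0 < h)
    (hx : ∀ t : ℝ≥0, x t = walk u z ⌊(t : ℝ) / h⌋₊) (t : ℝ) :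
    (dividend_mono ϑ x).stieltjesFunction t = excess u ϑ z ⌊t / h⌋₊ := by
  rw [Monotone.stieltjesFunction_eq]
  refine rightLim_eq_of_tendsto (tendsto_const_nhds.congr' ?_)
  rcases lt_or_ge t 0 with ht | ht
  · have : Set.Ioo t 0 ∈ 𝓝[>] t := Ioo_mem_nhdsGT ht
    filter_upwards [this] with s hs
    rw [dividend_step hϑ hh hx, Nat.floor_of_nonpos (div_nonpos_of_nonpos_of_nonneg ht.le hh.le),
      Nat.ceil_eq_zero.2 (div_nonpos_of_nonpos_of_nonneg hs.2.le hh.le)]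
  · have h1 : t < (⌊t / h⌋₊ + 1 : ℝ) * h := by
      rw [← div_lt_iff₀ hh]; exact Nat.lt_floor_add_one _
    filter_upwards [Ioo_mem_nhdsGT h1] with s hs
    rw [dividend_step hϑ hh hx]
    have h2 : ⌈s / h⌉₊ = ⌊t / h⌋₊ + 1 := by
      refine (Nat.ceil_eq_iff (by omega)).2 ⟨?_, ?_⟩
      · exact (Nat.floor_le (div_nonneg ht hh.le)).trans_lt (div_lt_div_of_pos_right hs.1 hh)
      · rw [div_le_iff₀ hh]; push_cast; exact hs.2.le
    rw [h2, Nat.add_sub_cancel]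

lemma excess_eq_of_le {n : ℕ} (hz : ∀ k, n ≤ k → z k = 0) {k : ℕ} (hk : n ≤ k) :
    excess u ϑ z (k + 1) = excess u ϑ z k := by
  have h1 : walk u z (k + 1) ≤ peak u z k := by
    rw [walk_succ, hz k hk, add_zero]
    exact le_partialSups_of_le _ le_rfl
  simp [excess, peak_succ, max_eq_left h1]

/-- On `(a, b]` the Stieltjes mass telescopes into the excess increments at the grid points inside;
from step `n` on the walk is constant, so finitely many atoms suffice. -/
lemma dividendMeasure_step (hϑ : u ≤ ϑ) (hh : 0 < h)
    (hx : ∀ t : ℝ≥0, x t = walk u z ⌊(t : ℝ) / h⌋₊) {n : ℕ} (hz : ∀ k, n ≤ k → z k = 0) :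
    dividendMeasure ϑ x = ∑ k ∈ Finset.range n,
      ENNReal.ofReal (excess u ϑ z (k + 1) - excess u ϑ z k) •
        Measure.dirac (((k : ℝ) + 1) * h) := by
  unfold dividendMeasure
  refine Measure.ext_of_Ioc _ _ fun a b hab => ?_
  rw [StieltjesFunction.measure_Ioc, stieltjes_step hϑ hh hx, stieltjes_step hϑ hh hx]
  have hfl : ⌊a / h⌋₊ ≤ ⌊b / h⌋₊ := Nat.floor_le_floor (div_le_div_of_nonneg_right hab.le hh.le)
  have hinc : ∀ k, 0 ≤ excess u ϑ z (k + 1) - excess u ϑ z k := fun k =>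
    sub_nonneg.2 (excess_mono u ϑ z k.le_succ)
  rw [← Finset.sum_Ico_sub _ hfl, ENNReal.ofReal_sum_of_nonneg fun k _ => hinc k]
  simp only [Measure.coe_finsetSum, Finset.sum_apply, Measure.smul_apply, smul_eq_mul]
  have hmem : ∀ k : ℕ, ((k : ℝ) + 1) * h ∈ Set.Ioc a b ↔ k ∈ Finset.Ico ⌊a / h⌋₊ ⌊b / h⌋₊ := by
    intro k
    rw [Set.mem_Ioc, Finset.mem_Ico, ← div_lt_iff₀ hh, ← le_div_iff₀ hh, ← Nat.lt_succ_iff (n := k),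
      Nat.floor_lt' (Nat.succ_ne_zero k), ← Nat.succ_le_iff (m := k),
      Nat.le_floor_iff' (Nat.succ_ne_zero k)]
    push_cast
    rfl
  have h1 : ∀ k : ℕ, Measure.dirac (((k : ℝ) + 1) * h) (Set.Ioc a b) =
      if k ∈ Finset.Ico ⌊a / h⌋₊ ⌊b / h⌋₊ then 1 else 0 := by
    intro k
    rw [Measure.dirac_apply' _ measurableSet_Ioc, Set.indicator_apply]
    simp only [hmem, Pi.one_apply]
  simp only [h1, mul_ite, mul_one, mul_zero]
  rw [← Finset.sum_filter]
  symm
  apply Finset.sum_subset_zero_on_sdiff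
  · intro k hk
    exact (Finset.mem_filter.1 hk).2
  · intro k hk
    have hkn : n ≤ k := by
      by_contra hlt
      exact (Finset.mem_sdiff.1 hk).2
        (Finset.mem_filter.2 ⟨Finset.mem_range.2 (not_le.1 hlt), (Finset.mem_sdiff.1 hk).1⟩)
    simp [excess_eq_of_le hz hkn]
  · intros; rfl

/-- At time `(j + 1) h` the left-continuous dividend is still `excess j`, which is the test in
`Solvent`; between grid points no new ruin can occur. -/
lemma lt_ruinTime_iff (hu : 0 ≤ u) (hϑ : u ≤ ϑ) (hh : 0 < h)
    (hx : ∀ t : ℝ≥0, x t = walk u z ⌊(t : ℝ) / h⌋₊) (k : ℕ) :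
    ENNReal.ofReal (k * h) < ruinTime ϑ x ↔ Solvent u ϑ z k := by
  constructor
  · intro hlt j hj
    by_contra hcon
    refine absurd hlt (not_lt.2 ?_)
    have hnn : 0 ≤ ((j : ℝ) + 1) * h := by positivity
    refine (sInf_le ⟨(((j : ℝ) + 1) * h).toNNReal, ⟨?_, ?_⟩, rfl⟩ : ruinTime ϑ x ≤ _).trans ?_
    · exact Real.toNNReal_pos.2 (by positivity)
    · rw [hx, Real.coe_toNNReal _ hnn, dividend_step hϑ hh hx, mul_div_assoc, div_self hh.ne',
        mul_one, show (j : ℝ) + 1 = ((j + 1 : ℕ) : ℝ) by push_cast; rfl, Nat.floor_natCast,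
        Nat.ceil_natCast, Nat.add_sub_cancel]
      linarith [not_le.1 hcon]
    · refine ENNReal.ofReal_le_ofReal (mul_le_mul_of_nonneg_right ?_ hh.le)
      exact_mod_cast hj
  · intro hs
    -- Solvency up to step `k` keeps the controlled path nonnegative up to the next grid point; this
    -- extra step gives the strict inequality.
    have hlow : ENNReal.ofReal (((k : ℝ) + 1) * h) ≤ ruinTime ϑ x := by
      refine le_sInf ?_
      rintro _ ⟨t, ⟨ht, hneg⟩, rfl⟩
      by_contra hcon
      have htk : (t : ℝ) < ((k : ℝ) + 1) * h := by
        have : (t : ℝ≥0∞) < ENNReal.ofReal (((k : ℝ) + 1) * h) := not_le.1 hcon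
        rw [← ENNReal.ofReal_coe_nnreal] at this
        exact (ENNReal.ofReal_lt_ofReal_iff (by positivity)).1 this
      have hfl : ⌊(t : ℝ) / h⌋₊ < k + 1 := by
        rw [Nat.floor_lt' (Nat.succ_ne_zero k), div_lt_iff₀ hh]
        push_cast
        exact htk
      have hD : dividend ϑ x t ≤ excess u ϑ z ⌊(t : ℝ) / h⌋₊ := by
        rw [dividend_step hϑ hh hx]
        refine excess_mono u ϑ z ?_
        have := Nat.ceil_le_floor_add_one ((t : ℝ) / h)
        omega
      have hw : excess u ϑ z ⌊(t : ℝ) / h⌋₊ ≤ walk u z ⌊(t : ℝ) / h⌋₊ := by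
        rcases hj : ⌊(t : ℝ) / h⌋₊ with _ | j
        · rw [excess_zero hϑ, walk_zero]; exact hu
        · exact excess_succ_le_walk hu hϑ (hs j (by omega))
      rw [hx] at hneg
      linarith
    refine lt_of_lt_of_le ?_ hlow
    exact (ENNReal.ofReal_lt_ofReal_iff (by positivity)).2
      (mul_lt_mul_of_pos_right (lt_add_one _) hh)

/-- The integration interval is open at `n h`, so the atom there is lost and only `n - 1` steps
count. -/
lemma presentValue_step (r : ℝ) (hu : 0 ≤ u) (hϑ : u ≤ ϑ) (hh : 0 < h)
    (hx : ∀ t : ℝ≥0, x t = walk u z ⌊(t : ℝ) / h⌋₊) {n : ℕ} (hz : ∀ k, n ≤ k → z k = 0) :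
    presentValue r ϑ (min (ruinTime ϑ x) (ENNReal.ofReal (n * h))) x =
      walkValue (Real.exp (-(r * h))) u (n - 1) ϑ z := by
  classical
  unfold presentValue
  set A : Set ℝ := {t : ℝ | 0 ≤ t ∧
    ENNReal.ofReal t < min (ruinTime ϑ x) (ENNReal.ofReal (n * h))} with hA
  have hAm : MeasurableSet A := by
    refine measurableSet_Ici.inter ?_
    exact measurableSet_lt ENNReal.measurable_ofReal measurable_const
  have hmem : ∀ k : ℕ, ((k : ℝ) + 1) * h ∈ A ↔ k + 1 < n ∧ Solvent u ϑ z (k + 1) := by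
    intro k
    have e := lt_ruinTime_iff hu hϑ hh hx (k + 1)
    push_cast at e
    have h0 : 0 ≤ ((k : ℝ) + 1) * h := by positivity
    have e2 : ENNReal.ofReal (((k : ℝ) + 1) * h) < ENNReal.ofReal (n * h) ↔ k + 1 < n := by
      rw [ENNReal.ofReal_lt_ofReal_iff_of_nonneg h0, mul_lt_mul_iff_left₀ hh]
      exact_mod_cast Iff.rfl
    rw [hA, Set.mem_ofPred_eq, lt_min_iff, e, e2]
    exact ⟨fun H => ⟨H.2.2, H.2.1⟩, fun H => ⟨h0, H.2, H.1⟩⟩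
  rw [dividendMeasure_step hϑ hh hx hz, ← integral_indicator hAm, integral_finsetSum_measure]
  · simp only [integral_smul_measure, integral_dirac]
    rw [walkValue]
    rcases n with _ | n
    · simp
    rw [Nat.add_sub_cancel, Finset.sum_range_succ, Set.indicator_of_notMem, smul_zero, add_zero]
    · refine Finset.sum_congr rfl fun k hk => ?_
      rw [Set.indicator_apply, ENNReal.toReal_ofReal
        (sub_nonneg.2 (excess_mono u ϑ z k.le_succ)), smul_eq_mul]
      have hk' : k + 1 < n + 1 := by simpa using hk
      simp only [hmem, hk', true_and]
      split_ifs
      · rw [← Real.exp_nat_mul, mul_comm]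
        congr 2
        push_cast
        ring
      · simp
    · rw [hmem]; omega
  · intro k _
    refine Integrable.smul_measure ?_ ENNReal.ofReal_ne_top
    exact integrable_dirac (by simp)

end StepPath

/-! ### Quasi-processes as walks with permuted increments -/

/-- Extension of a finite vector by zero. -/
def extendZero {n : ℕ} (y : Fin n → ℝ) (i : ℕ) : ℝ := if hi : i < n then y ⟨i, hi⟩ else 0

lemma extendZero_of_le {n : ℕ} (y : Fin n → ℝ) {i : ℕ} (hi : n ≤ i) : extendZero y i = 0 :=
  dif_neg (not_lt.2 hi)

lemma extendZero_val {n : ℕ} (y : Fin n → ℝ) (i : Fin n) : extendZero y i = y i := by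
  simp [extendZero]

/-- The vector of the first `n` increments of a path. -/
def increments (h : ℝ≥0) (n : ℕ) (x : CadlagPath) (i : Fin n) : ℝ := increment h x i

lemma quasiPath_apply {u : ℝ} {h : ℝ≥0} (hh : 0 < h) (n : ℕ) (p : Equiv.Perm (Fin n))
    (x : CadlagPath) (t : ℝ≥0) : quasiPath u h n p x t =
      walk u (extendZero (increments h n x ∘ p)) ⌊(t : ℝ) / h⌋₊ := by
  have hh' : (0 : ℝ) < h := hh
  show u + ∑ k : Fin n, increment h x (p k) *
    (Set.Ici (((k : ℕ) + 1 : ℝ≥0) * h)).indicator (fun _ => (1 : ℝ)) t = _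
  rw [walk]
  congr 1
  have e1 : ∀ k : Fin n, increment h x (p k) *
      (Set.Ici (((k : ℕ) + 1 : ℝ≥0) * h)).indicator (fun _ => (1 : ℝ)) t =
      if (k : ℕ) < ⌊(t : ℝ) / h⌋₊ then extendZero (increments h n x ∘ p) k else 0 := by
    intro k
    have : t ∈ Set.Ici (((k : ℕ) + 1 : ℝ≥0) * h) ↔ (k : ℕ) < ⌊(t : ℝ) / h⌋₊ := by
      rw [Set.mem_Ici, ← Nat.succ_le_iff, Nat.le_floor_iff' (Nat.succ_ne_zero _),
        le_div_iff₀ hh', ← NNReal.coe_le_coe]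
      push_cast
      rfl
    rw [extendZero_val, Set.indicator_apply]
    simp only [this]
    split_ifs <;> simp [increments]
  simp only [e1]
  rw [Fin.sum_univ_eq_sum_range (fun k => if k < ⌊(t : ℝ) / h⌋₊ then
    extendZero (increments h n x ∘ p) k else 0) n, ← Finset.sum_filter]
  apply Finset.sum_subset_zero_on_sdiff
  · intro k hk
    simpa using (Finset.mem_filter.1 hk).2
  · intro k hk
    apply extendZero_of_le
    by_contra hlt
    simp only [Finset.mem_sdiff, Finset.mem_range, Finset.mem_filter, not_and] at hk
    exact hk.2 (not_le.1 hlt) hk.1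
  · intros; rfl

lemma discreteValue_eq {u ϑ : ℝ} (r : ℝ) {h : ℝ≥0} (hu : 0 ≤ u) (hϑ : u ≤ ϑ) (hh : 0 < h)
    (n : ℕ) (x : CadlagPath) : discreteValue r u h n ϑ x =
      walkValue (Real.exp (-(r * h))) u (n - 1) ϑ (extendZero (increments h n x)) := by
  have e := presentValue_step (z := extendZero (increments h n x)) r hu hϑ
    (NNReal.coe_pos.2 hh) (quasiPath_apply hh n 1 x) (n := n) (fun k hk => extendZero_of_le _ hk)
  rw [← e, discreteValue]
  congr 2
  rw [← ENNReal.ofReal_coe_nnreal]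
  push_cast
  rfl

/-- This turns integration against `empiricalMeasure` into averaging over permuted increment
vectors. -/
lemma increments_quasiPath {u : ℝ} {h : ℝ≥0} (hh : 0 < h) (n : ℕ) (p : Equiv.Perm (Fin n))
    (x : CadlagPath) : increments h n (quasiPath u h n p x) = increments h n x ∘ p := by
  have hh' : (h : ℝ) ≠ 0 := (NNReal.coe_pos.2 hh).ne'
  funext i
  have e1 : ⌊(((i : ℕ) + 1 : ℝ≥0) * h : ℝ≥0) / (h : ℝ)⌋₊ = (i : ℕ) + 1 := by
    push_cast
    rw [mul_div_assoc, div_self hh', mul_one]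
    exact_mod_cast Nat.floor_natCast ((i : ℕ) + 1)
  have e2 : ⌊(((i : ℕ) : ℝ≥0) * h : ℝ≥0) / (h : ℝ)⌋₊ = (i : ℕ) := by
    push_cast
    rw [mul_div_assoc, div_self hh', mul_one, Nat.floor_natCast]
  rw [increments, increment, quasiPath_apply hh, quasiPath_apply hh, e1, e2, walk_succ,
    extendZero_val]
  simp

/-! ### Properties of the walk functionals -/

lemma walk_congr (u : ℝ) {z z' : ℕ → ℝ} {k : ℕ} (h : ∀ i < k, z i = z' i) :
    walk u z k = walk u z' k := by
  rw [walk, walk, Finset.sum_congr rfl fun i hi => h i (Finset.mem_range.1 hi)]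

lemma peak_congr (u : ℝ) {z z' : ℕ → ℝ} {k : ℕ} (h : ∀ i < k, z i = z' i) :
    peak u z k = peak u z' k := by
  induction k with
  | zero => simp [peak_zero]
  | succ k ih => rw [peak_succ, peak_succ, ih fun i hi => h i (by omega), walk_congr u h]

lemma excess_congr (u ϑ : ℝ) {z z' : ℕ → ℝ} {k : ℕ} (h : ∀ i < k, z i = z' i) :
    excess u ϑ z k = excess u ϑ z' k := by
  rw [excess, excess, peak_congr u h]

lemma solvent_congr (u ϑ : ℝ) {z z' : ℕ → ℝ} {k : ℕ} (h : ∀ i < k, z i = z' i) :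
    Solvent u ϑ z k ↔ Solvent u ϑ z' k := by
  refine forall₂_congr fun j hj => ?_
  rw [excess_congr u ϑ fun i hi => h i (by omega), walk_congr u fun i hi => h i (by omega)]

lemma walkValue_congr (β u : ℝ) {m : ℕ} (ϑ : ℝ) {z z' : ℕ → ℝ} (h : ∀ i < m, z i = z' i) :
    walkValue β u m ϑ z = walkValue β u m ϑ z' := by
  refine Finset.sum_congr rfl fun k hk => ?_
  have hk' : k < m := Finset.mem_range.1 hk
  have hs := solvent_congr u ϑ fun i (hi : i < k + 1) => h i (by omega)
  rw [excess_congr u ϑ fun i (hi : i < k + 1) => h i (by omega),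
    excess_congr u ϑ fun i (hi : i < k) => h i (by omega)]
  by_cases H : Solvent u ϑ z' (k + 1)
  · rw [if_pos H, if_pos (hs.2 H)]
  · rw [if_neg H, if_neg (mt hs.1 H)]

lemma measurable_walk (u : ℝ) (k : ℕ) : Measurable fun z : ℕ → ℝ => walk u z k := by
  unfold walk
  fun_prop

lemma measurable_peak (u : ℝ) (k : ℕ) : Measurable fun z : ℕ → ℝ => peak u z k := by
  induction k with
  | zero => simp [peak_zero]
  | succ k ih =>
    simp only [peak_succ]
    exact ih.max (measurable_walk u (k + 1))

lemma measurable_excess (u ϑ : ℝ) (k : ℕ) : Measurable fun z : ℕ → ℝ => excess u ϑ z k :=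
  ((measurable_peak u k).sub_const ϑ).max measurable_const

lemma measurableSet_solvent (u ϑ : ℝ) (k : ℕ) : MeasurableSet {z : ℕ → ℝ | Solvent u ϑ z k} := by
  have : {z : ℕ → ℝ | Solvent u ϑ z k} =
      ⋂ j, ⋂ (_ : j < k), {z : ℕ → ℝ | excess u ϑ z j ≤ walk u z (j + 1)} := by
    ext z; simp [Solvent]
  rw [this]
  exact MeasurableSet.iInter fun j => MeasurableSet.iInter fun _ =>
    measurableSet_le (measurable_excess u ϑ j) (measurable_walk u (j + 1))

lemma measurable_walkValue (β u : ℝ) (m : ℕ) (ϑ : ℝ) : Measurable (walkValue β u m ϑ) := by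
  classical
  unfold walkValue
  refine Finset.measurable_sum _ fun k _ => ?_
  exact Measurable.ite (measurableSet_solvent u ϑ (k + 1))
    (((measurable_excess u ϑ (k + 1)).sub (measurable_excess u ϑ k)).const_mul _) measurable_const

lemma measurable_extendZero (n : ℕ) : Measurable (extendZero : (Fin n → ℝ) → ℕ → ℝ) := by
  refine measurable_pi_lambda _ fun i => ?_
  unfold extendZero
  split_ifs <;> fun_prop

/-- The discounted increase of the running maximum between the steps `m` and `n`. -/
def discountedRise (β u : ℝ) (m n : ℕ) (z : ℕ → ℝ) : ℝ :=
  ∑ k ∈ Finset.Ico m n, β ^ (k + 1) * (peak u z (k + 1) - peak u z k)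

lemma measurable_discountedRise (β u : ℝ) (m n : ℕ) : Measurable (discountedRise β u m n) := by
  unfold discountedRise
  exact Finset.measurable_sum _ fun k _ =>
    ((measurable_peak u (k + 1)).sub (measurable_peak u k)).const_mul _

lemma discountedRise_nonneg {β : ℝ} (hβ : 0 ≤ β) (u : ℝ) (m n : ℕ) (z : ℕ → ℝ) :
    0 ≤ discountedRise β u m n z :=
  Finset.sum_nonneg fun k _ => mul_nonneg (pow_nonneg hβ _)
    (sub_nonneg.2 (peak_mono u z k.le_succ))

lemma discountedRise_congr (β u : ℝ) {m n : ℕ} {z z' : ℕ → ℝ} (h : ∀ i < n, z i = z' i) :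
    discountedRise β u m n z = discountedRise β u m n z' := by
  refine Finset.sum_congr rfl fun k hk => ?_
  have hk' := (Finset.mem_Ico.1 hk).2
  rw [peak_congr u fun i (hi : i < k + 1) => h i (by omega),
    peak_congr u fun i (hi : i < k) => h i (by omega)]

lemma excess_sub_le (u ϑ : ℝ) (z : ℕ → ℝ) (k : ℕ) :
    excess u ϑ z (k + 1) - excess u ϑ z k ≤ peak u z (k + 1) - peak u z k := by
  have := peak_mono u z k.le_succ
  simp only [excess]
  rcases le_total (peak u z k) ϑ with h1 | h1 <;> rcases le_total (peak u z (k + 1)) ϑ with h2 | h2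
  all_goals simp [h1, h2, sub_nonneg] <;> linarith

/-- The upper bound does not involve `ϑ`: for `m = 0` it is an envelope for all barriers, for
general `m` it controls the truncation error uniformly. -/
lemma walkValue_sub {β : ℝ} (u : ℝ) {m n : ℕ} (hmn : m ≤ n) (ϑ : ℝ) (z : ℕ → ℝ) (hβ : 0 ≤ β) :
    0 ≤ walkValue β u n ϑ z - walkValue β u m ϑ z ∧
    walkValue β u n ϑ z - walkValue β u m ϑ z ≤ discountedRise β u m n z := by
  classical
  rw [walkValue, walkValue, ← Finset.sum_Ico_eq_sub _ hmn]
  have h0 : ∀ k, 0 ≤ excess u ϑ z (k + 1) - excess u ϑ z k := fun k =>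
    sub_nonneg.2 (excess_mono u ϑ z k.le_succ)
  constructor
  · refine Finset.sum_nonneg fun k _ => ?_
    split_ifs
    · exact mul_nonneg (pow_nonneg hβ _) (h0 k)
    · exact le_rfl
  · refine Finset.sum_le_sum fun k _ => ?_
    split_ifs
    · exact mul_le_mul_of_nonneg_left (excess_sub_le u ϑ z k) (pow_nonneg hβ _)
    · exact mul_nonneg (pow_nonneg hβ _) (sub_nonneg.2 (peak_mono u z k.le_succ))

lemma walkValue_nonneg {β : ℝ} (u : ℝ) (m : ℕ) (ϑ : ℝ) (z : ℕ → ℝ) (hβ : 0 ≤ β) :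
    0 ≤ walkValue β u m ϑ z := by
  simpa [walkValue] using (walkValue_sub u (Nat.zero_le m) ϑ z hβ).1

lemma walkValue_le {β : ℝ} (u : ℝ) (m : ℕ) (ϑ : ℝ) (z : ℕ → ℝ) (hβ : 0 ≤ β) :
    walkValue β u m ϑ z ≤ discountedRise β u 0 m z := by
  simpa [walkValue] using (walkValue_sub u (Nat.zero_le m) ϑ z hβ).2

lemma excess_antitone (u : ℝ) (z : ℕ → ℝ) (k : ℕ) {ϑ ϑ' : ℝ} (h : ϑ ≤ ϑ') :
    excess u ϑ' z k ≤ excess u ϑ z k := max_le_max (by linarith) le_rfl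

/-- Raising the barrier by `δ` decreases the value by at most `δ`. -/
lemma walkValue_add_mono {β : ℝ} (hβ : 0 ≤ β) (hβ1 : β ≤ 1) (u : ℝ) (m : ℕ) (z : ℕ → ℝ) :
    Monotone fun ϑ => walkValue β u m ϑ z + ϑ := by
  classical
  intro ϑ ϑ' hle
  -- Each payout difference is at most the undiscounted increment of the gap between the two
  -- excesses, and these telescope.
  have hdiff : walkValue β u m ϑ z - walkValue β u m ϑ' z ≤
      ∑ k ∈ Finset.range m, ((excess u ϑ z (k + 1) - excess u ϑ' z (k + 1)) -
        (excess u ϑ z k - excess u ϑ' z k)) := by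
    rw [walkValue, walkValue, ← Finset.sum_sub_distrib]
    refine Finset.sum_le_sum fun k _ => ?_
    have hp := peak_mono u z k.le_succ
    have hgap : 0 ≤ (excess u ϑ z (k + 1) - excess u ϑ' z (k + 1)) -
        (excess u ϑ z k - excess u ϑ' z k) := by
      have key : ∀ a b : ℝ, a ≤ b → max (a - ϑ) 0 - max (a - ϑ') 0 ≤
          max (b - ϑ) 0 - max (b - ϑ') 0 := by
        intro a b hab
        rcases le_total a ϑ with h1 | h1 <;> rcases le_total a ϑ' with h2 | h2 <;>
          rcases le_total b ϑ with h3 | h3 <;> rcases le_total b ϑ' with h4 | h4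
        all_goals
          simp only [max_eq_left (sub_nonneg.2 _), max_eq_right (sub_nonpos.2 _), h1, h2, h3, h4]
          linarith
      have := key _ _ hp
      simp only [excess]
      linarith
    have hβk0 : 0 ≤ β ^ (k + 1) := pow_nonneg hβ _
    have hβk1 : β ^ (k + 1) ≤ 1 := pow_le_one₀ hβ hβ1
    -- The higher barrier pays less and survives longer, so ruin can remove a payout from the lower
    -- barrier alone, never from the higher one alone.
    have hs : Solvent u ϑ z (k + 1) → Solvent u ϑ' z (k + 1) := fun H j hj =>
      (excess_antitone u z j hle).trans (H j hj)
    have hD' := excess_mono u ϑ' z k.le_succ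
    by_cases h1 : Solvent u ϑ z (k + 1)
    · rw [if_pos h1, if_pos (hs h1)]
      nlinarith
    · rw [if_neg h1]
      have : 0 ≤ if Solvent u ϑ' z (k + 1) then
          β ^ (k + 1) * (excess u ϑ' z (k + 1) - excess u ϑ' z k) else 0 := by
        split_ifs
        · exact mul_nonneg hβk0 (sub_nonneg.2 hD')
        · exact le_rfl
      linarith
  rw [Finset.sum_range_sub (fun k => excess u ϑ z k - excess u ϑ' z k)] at hdiff
  have h0 := excess_antitone u z 0 hle
  have hm : excess u ϑ z m - excess u ϑ' z m ≤ ϑ' - ϑ := by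
    have : excess u ϑ z m ≤ excess u ϑ' z m + (ϑ' - ϑ) := by
      refine max_le ?_ ?_
      · have : peak u z m - ϑ' ≤ excess u ϑ' z m := le_max_left _ _
        linarith
      · have : 0 ≤ excess u ϑ' z m := le_max_right _ _
        linarith
    linarith
  show walkValue β u m ϑ z + ϑ ≤ walkValue β u m ϑ' z + ϑ'
  linarith

/-! ### Second moment of the discounted rise -/

/-- Summation by parts; the boundary term at `m` is nonpositive and is dropped. -/
lemma discountedRise_le {β : ℝ} (hβ : 0 ≤ β) (u : ℝ) {m n : ℕ} (hmn : m ≤ n) (z : ℕ → ℝ) :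
    discountedRise β u m n z ≤ β ^ n * (peak u z n - u) +
      ∑ k ∈ Finset.Ico m n, (β ^ k - β ^ (k + 1)) * (peak u z k - u) := by
  induction n, hmn using Nat.le_induction with
  | base =>
    simp only [discountedRise, Finset.Ico_self, Finset.sum_empty, add_zero]
    exact mul_nonneg (pow_nonneg hβ _) (sub_nonneg.2 (le_peak u z m))
  | succ n hn ih =>
    rw [discountedRise, Finset.sum_Ico_succ_top hn, ← discountedRise, Finset.sum_Ico_succ_top hn]
    linarith

lemma discountedRise_sq_le {β : ℝ} (hβ : 0 ≤ β) (hβ1 : β ≤ 1) (u : ℝ) {m n : ℕ} (hmn : m ≤ n)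
    (z : ℕ → ℝ) : discountedRise β u m n z ^ 2 ≤ β ^ m * (β ^ n * (peak u z n - u) ^ 2 +
      ∑ k ∈ Finset.Ico m n, (β ^ k - β ^ (k + 1)) * (peak u z k - u) ^ 2) := by
  -- The weights of the summation by parts, of telescoping total mass `β ^ m`; Cauchy–Schwarz with
  -- them produces the factor `β ^ m`.
  set w : ℕ → ℝ := fun k => if k < n then β ^ k - β ^ (k + 1) else β ^ n with hw
  have hw0 : ∀ k, 0 ≤ w k := by
    intro k
    simp only [hw]
    split_ifs
    · exact sub_nonneg.2 (pow_le_pow_of_le_one hβ hβ1 k.le_succ)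
    · exact pow_nonneg hβ _
  have hsum : ∀ a : ℕ → ℝ, ∑ k ∈ Finset.Ico m (n + 1), w k * a k =
      β ^ n * a n + ∑ k ∈ Finset.Ico m n, (β ^ k - β ^ (k + 1)) * a k := by
    intro a
    rw [Finset.sum_Ico_succ_top hmn, add_comm]
    congr 1
    · simp [hw]
    · exact Finset.sum_congr rfl fun k hk => by simp [hw, (Finset.mem_Ico.1 hk).2]
  have htot : ∑ k ∈ Finset.Ico m (n + 1), w k = β ^ m := by
    have h1 := hsum fun _ => 1
    simp only [mul_one] at h1
    rw [h1]
    have h2 := Finset.sum_Ico_sub (fun k => - β ^ k) hmn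
    simp only [neg_sub_neg] at h2
    rw [h2]; ring
  have hle := discountedRise_le hβ u hmn z
  rw [← hsum fun k => peak u z k - u] at hle
  rw [← hsum fun k => (peak u z k - u) ^ 2, ← htot]
  refine (pow_le_pow_left₀ (discountedRise_nonneg hβ u m n z) hle 2).trans ?_
  refine Finset.sum_sq_le_sum_mul_sum_of_sq_le_mul _ (fun k _ => hw0 k)
    (fun k _ => mul_nonneg (hw0 k) (sq_nonneg _)) fun k _ => le_of_eq (by ring)

/-- Half of the discount `γ ^ 2` absorbs growth of order `γ⁻¹ ^ k`; since `1 - γ ^ 2 ≤ 2 (1 - γ)`,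
the remaining sum is dominated by a telescoping one. -/
lemma discount_weights_le {γ : ℝ} (hγ : 0 < γ) (hγ1 : γ ≤ 1) {m n : ℕ} (hmn : m ≤ n) :
    (γ ^ 2) ^ n * γ⁻¹ ^ n + ∑ k ∈ Finset.Ico m n,
      ((γ ^ 2) ^ k - (γ ^ 2) ^ (k + 1)) * γ⁻¹ ^ k ≤ 2 := by
  have e : ∀ k : ℕ, (γ ^ 2) ^ k * γ⁻¹ ^ k = γ ^ k := by
    intro k
    rw [← mul_pow]
    congr 1
    field_simp
  have h1 : ∀ k ∈ Finset.Ico m n, ((γ ^ 2) ^ k - (γ ^ 2) ^ (k + 1)) * γ⁻¹ ^ k ≤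
      2 * ((-γ ^ (k + 1)) - (-γ ^ k)) := by
    intro k _
    have : ((γ ^ 2) ^ k - (γ ^ 2) ^ (k + 1)) * γ⁻¹ ^ k = γ ^ k * (1 - γ ^ 2) := by
      rw [pow_succ, ← e k]; ring
    rw [this, pow_succ γ k]
    have := pow_pos hγ k
    nlinarith [mul_nonneg this.le (sq_nonneg (1 - γ))]
  refine (add_le_add_right (Finset.sum_le_sum h1) _).trans ?_
  rw [← Finset.mul_sum, Finset.sum_Ico_sub (fun k => - γ ^ k) hmn, e]
  have := pow_le_one₀ (n := m) hγ.le hγ1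
  have := pow_pos hγ n
  linarith

section Moments

variable {Ω : Type*} [MeasurableSpace Ω] {μ : Measure Ω}

lemma discountedRise_sq_integral_le {γ u K : ℝ} (hγ : 0 < γ) (hγ1 : γ ≤ 1) {m n : ℕ}
    (hmn : m ≤ n) {V : Ω → ℕ → ℝ} (hV : Measurable V)
    (hint : ∀ k ≤ n, Integrable (fun ω => (peak u (V ω) k - u) ^ 2) μ)
    (hK : ∀ k ≤ n, ∫ ω, (peak u (V ω) k - u) ^ 2 ∂μ ≤ K * γ⁻¹ ^ k) :
    Integrable (fun ω => discountedRise (γ ^ 2) u m n (V ω) ^ 2) μ ∧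
    ∫ ω, discountedRise (γ ^ 2) u m n (V ω) ^ 2 ∂μ ≤ 2 * K * (γ ^ 2) ^ m := by
  have hβ : 0 ≤ γ ^ 2 := sq_nonneg γ
  have hβ1 : γ ^ 2 ≤ 1 := pow_le_one₀ hγ.le hγ1
  have hbint : Integrable (fun ω => (γ ^ 2) ^ m * ((γ ^ 2) ^ n * (peak u (V ω) n - u) ^ 2 +
      ∑ k ∈ Finset.Ico m n, ((γ ^ 2) ^ k - (γ ^ 2) ^ (k + 1)) * (peak u (V ω) k - u) ^ 2)) μ := by
    refine (((hint n le_rfl).const_mul _).add ?_).const_mul _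
    exact integrable_finsetSum _ fun k hk => (hint k (Finset.mem_Ico.1 hk).2.le).const_mul _
  have hK0 : 0 ≤ K := by
    have := (integral_nonneg fun ω => sq_nonneg (peak u (V ω) 0 - u)).trans (hK 0 n.zero_le)
    simpa using this
  have hle : ∀ ω, discountedRise (γ ^ 2) u m n (V ω) ^ 2 ≤ _ := fun ω =>
    discountedRise_sq_le hβ hβ1 u hmn (V ω)
  have hI : Integrable (fun ω => discountedRise (γ ^ 2) u m n (V ω) ^ 2) μ := by
    refine hbint.mono' (((measurable_discountedRise _ u m n).comp hV).pow_const 2).aestronglyMeasurable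
      (ae_of_all _ fun ω => ?_)
    rw [Real.norm_of_nonneg (sq_nonneg _)]
    exact hle ω
  refine ⟨hI, (integral_mono hI hbint hle).trans ?_⟩
  rw [integral_const_mul, integral_add ((hint n le_rfl).const_mul _)
    (integrable_finsetSum _ fun k hk => (hint k (Finset.mem_Ico.1 hk).2.le).const_mul _),
    integral_const_mul, integral_finsetSum _
      fun k hk => (hint k (Finset.mem_Ico.1 hk).2.le).const_mul _]
  simp only [integral_const_mul]
  have h1 : (γ ^ 2) ^ n * ∫ ω, (peak u (V ω) n - u) ^ 2 ∂μ ≤ (γ ^ 2) ^ n * (K * γ⁻¹ ^ n) :=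
    mul_le_mul_of_nonneg_left (hK n le_rfl) (pow_nonneg hβ _)
  have h2 : ∑ k ∈ Finset.Ico m n, ((γ ^ 2) ^ k - (γ ^ 2) ^ (k + 1)) *
      ∫ ω, (peak u (V ω) k - u) ^ 2 ∂μ ≤
      ∑ k ∈ Finset.Ico m n, ((γ ^ 2) ^ k - (γ ^ 2) ^ (k + 1)) * (K * γ⁻¹ ^ k) :=
    Finset.sum_le_sum fun k hk => mul_le_mul_of_nonneg_left (hK k (Finset.mem_Ico.1 hk).2.le)
      (sub_nonneg.2 (pow_le_pow_of_le_one hβ hβ1 k.le_succ))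
  have h3 : (γ ^ 2) ^ n * (K * γ⁻¹ ^ n) +
      ∑ k ∈ Finset.Ico m n, ((γ ^ 2) ^ k - (γ ^ 2) ^ (k + 1)) * (K * γ⁻¹ ^ k) =
      K * ((γ ^ 2) ^ n * γ⁻¹ ^ n + ∑ k ∈ Finset.Ico m n,
      ((γ ^ 2) ^ k - (γ ^ 2) ^ (k + 1)) * γ⁻¹ ^ k) := by
    rw [mul_add, Finset.mul_sum]
    congr 1
    · ring
    · exact Finset.sum_congr rfl fun k _ => by ring
  have h4 := mul_le_mul_of_nonneg_left (discount_weights_le hγ hγ1 hmn) hK0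
  calc _ ≤ (γ ^ 2) ^ m * (K * 2) := by
        refine mul_le_mul_of_nonneg_left ?_ (pow_nonneg hβ _)
        linarith
    _ = _ := by ring

/-! ### A maximal inequality -/

/-- The pathwise form of Doob's `L²` inequality. -/
lemma peak_sq_le (z : ℕ → ℝ) (k : ℕ) :
    peak 0 z k ^ 2 ≤ 4 * walk 0 z k ^ 2 - 4 * ∑ i ∈ Finset.range k, peak 0 z i * z i := by
  -- A discrete integration by parts. The claim then follows from `2 M W ≤ M² / 2 + 2 W²`.
  have key : peak 0 z k ^ 2 ≤ 2 * peak 0 z k * walk 0 z k -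
      2 * ∑ i ∈ Finset.range k, peak 0 z i * z i := by
    induction k with
    | zero => simp [peak_zero]
    | succ k ih =>
      rw [Finset.sum_range_succ, peak_succ]
      have hw := walk_succ 0 z k
      rcases le_total (walk 0 z (k + 1)) (peak 0 z k) with h | h
      · rw [max_eq_left h, hw]
        linarith
      · rw [max_eq_right h, show z k = walk 0 z (k + 1) - walk 0 z k by rw [hw]; ring]
        nlinarith [sq_nonneg (walk 0 z (k + 1) - peak 0 z k)]
  nlinarith [sq_nonneg (peak 0 z k - 2 * walk 0 z k)]

lemma peak_le_sum_abs (z : ℕ → ℝ) (k : ℕ) : peak 0 z k ≤ ∑ i ∈ Finset.range k, |z i| := by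
  refine partialSups_le _ _ _ fun j hj => ?_
  rw [walk, zero_add]
  refine (Finset.sum_le_sum fun i _ => le_abs_self (z i)).trans ?_
  exact Finset.sum_le_sum_of_subset_of_nonneg (Finset.range_mono hj) fun _ _ _ => abs_nonneg _

lemma peak_memLp {ξ : ℕ → Ω → ℝ} (hm : ∀ i, Measurable (ξ i)) (hL : ∀ i, MemLp (ξ i) 2 μ) (k : ℕ) :
    MemLp (fun ω => peak 0 (fun i => ξ i ω) k) 2 μ := by
  have hb : MemLp (fun ω => ∑ i ∈ Finset.range k, |ξ i ω|) 2 μ :=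
    memLp_finsetSum _ fun i _ => (hL i).abs
  refine hb.mono' ((measurable_peak 0 k).comp (measurable_pi_lambda _ hm)).aestronglyMeasurable
    (ae_of_all _ fun ω => ?_)
  rw [Real.norm_of_nonneg (le_peak 0 _ k)]
  exact peak_le_sum_abs _ k

/-- The maximum up to step `k` reads only the increments before index `k`, so the sum in
`peak_sq_le` is a martingale transform. -/
lemma indepFun_peak {ξ : ℕ → Ω → ℝ} (hm : ∀ i, Measurable (ξ i)) (hind : iIndepFun ξ μ) (k : ℕ) :
    IndepFun (fun ω => peak 0 (fun i => ξ i ω) k) (ξ k) μ := by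
  have h := hind.indepFun_finset (Finset.range k) {k} (by simp) hm
  let φ : (Finset.range k → ℝ) → ℝ := fun y =>
    peak 0 (fun j => if hj : j ∈ Finset.range k then y ⟨j, hj⟩ else 0) k
  have hφ : Measurable φ := by
    refine (measurable_peak 0 k).comp (measurable_pi_lambda _ fun j => ?_)
    split_ifs <;> fun_prop
  let ψ : (({k} : Finset ℕ) → ℝ) → ℝ := fun y => y ⟨k, Finset.mem_singleton_self k⟩
  have hψ : Measurable ψ := measurable_pi_apply _
  have h2 := h.comp hφ hψ
  convert! h2 using 1
  funext ω
  exact peak_congr 0 fun i hi => by simp [hi]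

/-- Take expectations in `peak_sq_le`: the martingale transform has mean zero and the squared walk
has mean `k v`. -/
lemma peak_sq_integral_le [IsProbabilityMeasure μ] {ξ : ℕ → Ω → ℝ} (hm : ∀ i, Measurable (ξ i))
    (hind : iIndepFun ξ μ) (hL : ∀ i, MemLp (ξ i) 2 μ) (h0 : ∀ i, ∫ ω, ξ i ω ∂μ = 0) {v : ℝ}
    (hv : ∀ i, Var[ξ i; μ] = v) (k : ℕ) :
    ∫ ω, peak 0 (fun i => ξ i ω) k ^ 2 ∂μ ≤ 4 * (k * v) := by
  have hpk := fun i => peak_memLp hm hL i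
  have hprod : ∀ i, Integrable (fun ω => peak 0 (fun i => ξ i ω) i * ξ i ω) μ := fun i =>
    (hpk i).integrable_mul (hL i)
  have hwL : MemLp (fun ω => walk 0 (fun i => ξ i ω) k) 2 μ := by
    simp only [walk, zero_add]
    exact memLp_finsetSum _ fun i _ => hL i
  have hw : ∫ ω, walk 0 (fun i => ξ i ω) k ^ 2 ∂μ = k * v := by
    have hsum : Var[∑ i ∈ Finset.range k, ξ i; μ] = ∑ i ∈ Finset.range k, Var[ξ i; μ] :=
      IndepFun.variance_sum (fun i _ => hL i) fun i _ j _ hij => hind.indepFun hij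
    have hfun : (∑ i ∈ Finset.range k, ξ i) = fun ω => walk 0 (fun i => ξ i ω) k := by
      funext ω; simp [walk]
    rw [hfun, variance_of_integral_eq_zero hwL.aemeasurable] at hsum
    · rw [hsum]; simp [hv]
    · simp only [walk, zero_add]
      rw [integral_finsetSum _ fun i _ => (hL i).integrable (by norm_num)]
      simp [h0]
  have hzero : ∀ i, ∫ ω, peak 0 (fun i => ξ i ω) i * ξ i ω ∂μ = 0 := by
    intro i
    rw [(indepFun_peak hm hind i).integral_fun_mul_eq_mul_integral
      (hpk i).aestronglyMeasurable (hL i).aestronglyMeasurable, h0, mul_zero]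
  have hsumint : Integrable (fun ω => 4 * ∑ i ∈ Finset.range k,
      peak 0 (fun i => ξ i ω) i * ξ i ω) μ :=
    (integrable_finsetSum _ fun i _ => hprod i).const_mul 4
  calc _ ≤ ∫ ω, (4 * walk 0 (fun i => ξ i ω) k ^ 2 -
        4 * ∑ i ∈ Finset.range k, peak 0 (fun i => ξ i ω) i * ξ i ω) ∂μ :=
        integral_mono (hpk k).integrable_sq ((hwL.integrable_sq.const_mul 4).sub hsumint)
          fun ω => peak_sq_le _ k
    _ = 4 * (k * v) := by
        rw [integral_sub (hwL.integrable_sq.const_mul 4) hsumint, integral_const_mul,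
          integral_const_mul, integral_finsetSum _ fun i _ => hprod i, hw]
        simp [hzero]

end Moments

/-! ### Increments of the risk process -/

section Risk

variable {Ω : Type*} [MeasurableSpace Ω] {μ : Measure Ω}

lemma measurable_eval (t : ℝ≥0) : Measurable fun x : CadlagPath => x t :=
  (measurable_pi_apply t).comp (comap_measurable CadlagPath.toFun)

lemma measurable_increment (h : ℝ≥0) : Measurable (increment h) :=
  measurable_pi_lambda _ fun _ => (measurable_eval _).sub (measurable_eval _)

lemma measurable_increments (h : ℝ≥0) (n : ℕ) : Measurable (increments h n) :=
  measurable_pi_lambda _ fun _ => (measurable_eval _).sub (measurable_eval _)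

/-- The increments of a process over the grid of mesh `h`. -/
def gridIncrement (h : ℝ≥0) (Y : ℝ≥0 → Ω → ℝ) (k : ℕ) (ω : Ω) : ℝ :=
  Y ((k + 1) * h) ω - Y (k * h) ω

lemma iIndepFun_gridIncrement {Y : ℝ≥0 → Ω → ℝ} (hY : HasIndepIncrements Y μ) (h : ℝ≥0) :
    iIndepFun (gridIncrement h Y) μ := by
  have hmono : Monotone fun k : ℕ => (k : ℝ≥0) * h := fun i j hij =>
    mul_le_mul_left (Nat.cast_le.2 hij) h
  convert! hY.nat hmono using 2 with k
  funext ω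
  simp [gridIncrement]

lemma hasLaw_gridIncrement {W : ℝ≥0 → Ω → ℝ} (hW : IsBrownianReal W μ) (h : ℝ≥0) (k : ℕ) :
    HasLaw (gridIncrement h W k) (gaussianReal 0 h) μ := by
  have e := hW.hasLaw_sub ((k + 1) * h) (k * h)
  have hd : nndist (((k + 1) * h : ℝ≥0) : ℝ) ((k * h : ℝ≥0) : ℝ) = h := by
    refine NNReal.eq ?_
    rw [coe_nndist, Real.dist_eq]
    push_cast
    rw [show ((k : ℝ) + 1) * h - k * h = h by ring]
    exact abs_of_nonneg h.2
  have hd' : nndist (((k + 1) * h : ℝ≥0) : ℝ≥0).1 ((k * h : ℝ≥0) : ℝ≥0).1 = h := hd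
  rw [hd'] at e
  exact e

lemma map_pi_gridIncrement [IsProbabilityMeasure μ] {Y : ℝ≥0 → Ω → ℝ} (hm : ∀ t, Measurable (Y t))
    (hY : HasIndepIncrements Y μ) {h : ℝ≥0} {κ : Measure ℝ}
    (hlaw : ∀ k, μ.map (gridIncrement h Y k) = κ) (n : ℕ) :
    μ.map (fun ω (i : Fin n) => gridIncrement h Y i ω) = Measure.pi fun _ => κ := by
  have hm' : ∀ k, Measurable (gridIncrement h Y k) := fun k => (hm _).sub (hm _)
  have hi : iIndepFun (fun i : Fin n => gridIncrement h Y i) μ :=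
    (iIndepFun_gridIncrement hY h).precomp Fin.val_injective
  rw [(iIndepFun_iff_map_fun_eq_pi_map fun i : Fin n => (hm' i).aemeasurable).1 hi]
  simp only [hlaw]

lemma pi_prod_pi_map {n : ℕ} {α β γ : Type*} [MeasurableSpace α] [MeasurableSpace β]
    [MeasurableSpace γ] (κ : Measure α) (η : Measure β) [IsProbabilityMeasure κ]
    [IsProbabilityMeasure η] {f : α × β → γ} (hf : Measurable f) :
    ((Measure.pi fun _ : Fin n => κ).prod (Measure.pi fun _ : Fin n => η)).map
      (fun p i => f (p.1 i, p.2 i)) = Measure.pi fun _ => (κ.prod η).map f := by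
  have h1 := measurePreserving_arrowProdEquivProdArrow α β (Fin n) (fun _ => κ) (fun _ => η)
  rw [← h1.map_eq, Measure.map_map (by fun_prop) (MeasurableEquiv.measurable _)]
  have hp : IsProbabilityMeasure ((κ.prod η).map f) :=
    Measure.isProbabilityMeasure_map hf.aemeasurable
  exact Measure.pi_map_pi (f := fun _ => f) fun _ => hf.aemeasurable

variable {u c σ : ℝ} {W S : ℝ≥0 → Ω → ℝ} {ν : Measure ℝ} {X : Ω → CadlagPath}

lemma IsRiskProcess.increment_eq (hX : IsRiskProcess μ u c σ W S ν X) (h : ℝ≥0) :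
    ∀ᵐ ω ∂μ, ∀ k : ℕ, increment h (X ω) k =
      c * h + σ * gridIncrement h W k ω - gridIncrement h S k ω := by
  filter_upwards [hX.eq] with ω hω k
  rw [increment, hω, hω, gridIncrement, gridIncrement]
  push_cast
  ring

/-- The claims only lower the path and the premium drift is largest at the last step, so only the
Brownian maximum remains. -/
lemma IsRiskProcess.peak_le (hX : IsRiskProcess μ u c σ W S ν X) (h : ℝ≥0) :
    ∀ᵐ ω ∂μ, ∀ k : ℕ, peak u (increment h (X ω)) k - u ≤
      c * (k * h) + σ * peak 0 (fun i => gridIncrement h W i ω) k := by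
  filter_upwards [hX.increment_eq h, hX.subordinator.mono] with ω hω hmono k
  rw [sub_le_iff_le_add]
  refine partialSups_le _ _ _ fun j hj => ?_
  have hS : 0 ≤ ∑ i ∈ Finset.range j, gridIncrement h S i ω := by
    refine Finset.sum_nonneg fun i _ => sub_nonneg.2 (hmono ?_)
    exact mul_le_mul_left (le_add_of_nonneg_right zero_le_one) h
  have hw : walk u (increment h (X ω)) j = u + (c * (j * h) +
      σ * walk 0 (fun i => gridIncrement h W i ω) j -
      ∑ i ∈ Finset.range j, gridIncrement h S i ω) := by
    simp only [walk, hω, Finset.sum_sub_distrib, Finset.sum_add_distrib, Finset.sum_const,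
      Finset.card_range, nsmul_eq_mul, ← Finset.mul_sum]
    ring
  have hpk : walk 0 (fun i => gridIncrement h W i ω) j ≤
      peak 0 (fun i => gridIncrement h W i ω) k := le_partialSups_of_le _ hj
  have h1 := mul_le_mul_of_nonneg_left hpk hX.vol_nonneg
  have h2 : c * (j * h) ≤ c * (k * h) := by
    have : (j : ℝ) ≤ k := by exact_mod_cast hj
    exact mul_le_mul_of_nonneg_left (mul_le_mul_of_nonneg_right this h.2) hX.premium_pos.le
  rw [hw]
  linarith

variable [IsProbabilityMeasure μ]

/-- The increments of the risk process over a grid are independent and identically distributed. -/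
lemma IsRiskProcess.exists_map_increments (hX : IsRiskProcess μ u c σ W S ν X) (h : ℝ≥0) (n : ℕ) :
    ∃ κ : Measure ℝ, IsProbabilityMeasure κ ∧
      μ.map (fun ω => increments h n (X ω)) = Measure.pi fun _ => κ := by
  have hSL := hX.subordinator.isLevyProcess
  have hWm := hX.measurable_W
  have hSm := hSL.measurable
  let f : ℝ × ℝ → ℝ := fun p => c * h + σ * p.1 - p.2
  have hf : Measurable f := by fun_prop
  have hSp : IsProbabilityMeasure (μ.map (S h)) :=
    Measure.isProbabilityMeasure_map (hSm h).aemeasurable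
  have hWlaw := map_pi_gridIncrement hWm hX.wiener.hasIndepIncrements (h := h)
    (fun k => (hasLaw_gridIncrement hX.wiener h k).map_eq) n
  have hSlaw := map_pi_gridIncrement hSm hSL.indep_increments (h := h) (κ := μ.map (S h))
    (fun k => by
      rw [← (hSL.stationary_increments (k * h) h).map_eq]
      congr 1
      funext ω
      rw [gridIncrement, show ((k : ℝ≥0) + 1) * h = k * h + h by ring]) n
  let g : (ℝ≥0 → ℝ) → Fin n → ℝ := fun w i => w (((i : ℕ) + 1) * h) - w ((i : ℕ) * h)
  have hg : Measurable g := by fun_prop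
  have hind : IndepFun (fun ω (i : Fin n) => gridIncrement h W i ω)
      (fun ω (i : Fin n) => gridIncrement h S i ω) μ := hX.indep.comp hg hg
  have hmW : Measurable fun ω (i : Fin n) => gridIncrement h W i ω :=
    measurable_pi_lambda _ fun i => (hWm _).sub (hWm _)
  have hmS : Measurable fun ω (i : Fin n) => gridIncrement h S i ω :=
    measurable_pi_lambda _ fun i => (hSm _).sub (hSm _)
  have hjoint := (indepFun_iff_map_prod_eq_prod_map_map hmW.aemeasurable hmS.aemeasurable).1 hind
  rw [hWlaw, hSlaw] at hjoint
  refine ⟨((gaussianReal 0 h).prod (μ.map (S h))).map f,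
    Measure.isProbabilityMeasure_map hf.aemeasurable, ?_⟩
  rw [← pi_prod_pi_map _ _ hf, ← hjoint, Measure.map_map (by fun_prop) (hmW.prodMk hmS)]
  refine Measure.map_congr ?_
  filter_upwards [hX.increment_eq h] with ω hω
  funext i
  exact hω i

lemma IsRiskProcess.peak_sq_integral (hX : IsRiskProcess μ u c σ W S ν X) (h : ℝ≥0) (k : ℕ) :
    Integrable (fun ω => (peak u (increment h (X ω)) k - u) ^ 2) μ ∧
    ∫ ω, (peak u (increment h (X ω)) k - u) ^ 2 ∂μ ≤
      2 * c ^ 2 * (k * h) ^ 2 + 8 * σ ^ 2 * (k * h) := by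
  have hWm := hX.measurable_W
  have hξm : ∀ i, Measurable (gridIncrement h W i) := fun i => (hWm _).sub (hWm _)
  have hlaw := hasLaw_gridIncrement hX.wiener h
  have hL : ∀ i, MemLp (gridIncrement h W i) 2 μ := fun i => (hlaw i).hasGaussianLaw.memLp_two
  have hpk := (peak_memLp hξm hL k).integrable_sq
  have hDoob := peak_sq_integral_le hξm (iIndepFun_gridIncrement hX.wiener.hasIndepIncrements h) hL
    (fun i => by rw [(hlaw i).integral_eq, integral_id_gaussianReal])
    (v := h) (fun i => by rw [(hlaw i).variance_eq, variance_id_gaussianReal]) k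
  have hb : ∀ᵐ ω ∂μ, (peak u (increment h (X ω)) k - u) ^ 2 ≤ 2 * (c * (k * h)) ^ 2 +
      2 * σ ^ 2 * peak 0 (fun i => gridIncrement h W i ω) k ^ 2 := by
    filter_upwards [hX.peak_le h] with ω hω
    have h0 := sub_nonneg.2 (le_peak u (increment h (X ω)) k)
    have h1 := pow_le_pow_left₀ h0 (hω k) 2
    have h2 := sq_nonneg (c * (k * h) - σ * peak 0 (fun i => gridIncrement h W i ω) k)
    nlinarith
  have hbi : Integrable (fun ω => 2 * (c * (k * h)) ^ 2 +
      2 * σ ^ 2 * peak 0 (fun i => gridIncrement h W i ω) k ^ 2) μ :=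
    (integrable_const _).add (hpk.const_mul _)
  have hI : Integrable (fun ω => (peak u (increment h (X ω)) k - u) ^ 2) μ := by
    refine hbi.mono' ((((measurable_peak u k).comp ((measurable_increment h).comp
      hX.measurable)).sub_const u).pow_const 2).aestronglyMeasurable ?_
    filter_upwards [hb] with ω hω
    rwa [Real.norm_of_nonneg (sq_nonneg _)]
  refine ⟨hI, (integral_mono_ae hI hbi hb).trans ?_⟩
  rw [integral_add (integrable_const _) (hpk.const_mul _), integral_const, integral_const_mul]
  simp only [probReal_univ, one_smul]
  have := mul_le_mul_of_nonneg_left hDoob (by positivity : 0 ≤ 2 * σ ^ 2)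
  linarith

/-- A bound on the second moments of the discounted rise, uniform in the mesh of the grid. -/
lemma IsRiskProcess.exists_discountedRise_bound (hX : IsRiskProcess μ u c σ W S ν X) {r : ℝ}
    (hr : 0 < r) : ∃ C : ℝ, 0 ≤ C ∧ ∀ (h : ℝ≥0) (m n : ℕ), m ≤ n →
      Integrable (fun ω => discountedRise (Real.exp (-(r * h))) u m n (increment h (X ω)) ^ 2) μ ∧
      ∫ ω, discountedRise (Real.exp (-(r * h))) u m n (increment h (X ω)) ^ 2 ∂μ ≤
        C * Real.exp (-(r * (m * h))) := by
  -- Chosen so that `2 c² t² + 8 σ² t ≤ K exp (r t / 2)` for all `t = k h`, from `s ≤ exp s` and `s²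
  -- / 2 ≤ exp s` at `s = r t / 2`. The bound depends on time only, hence is uniform in the mesh.
  set K : ℝ := 16 * c ^ 2 / r ^ 2 + 16 * σ ^ 2 / r with hK
  refine ⟨2 * K, by positivity, fun h m n hmn => ?_⟩
  set γ : ℝ := Real.exp (-(r * h / 2)) with hγ
  have hγ2 : Real.exp (-(r * h)) = γ ^ 2 := by
    rw [hγ, ← Real.exp_nat_mul]; congr 1; push_cast; ring
  have hγm : Real.exp (-(r * (m * h))) = (γ ^ 2) ^ m := by
    rw [← hγ2, ← Real.exp_nat_mul]; congr 1; ring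
  rw [hγ2, hγm]
  have hh : (0 : ℝ) ≤ h := h.2
  refine discountedRise_sq_integral_le (Real.exp_pos _) ?_ hmn
    ((measurable_increment h).comp hX.measurable) (fun k _ => (hX.peak_sq_integral h k).1)
    fun k _ => (hX.peak_sq_integral h k).2.trans ?_
  · exact Real.exp_le_one_iff.2 (by have := mul_nonneg hr.le hh; linarith)
  · have hinv : γ⁻¹ ^ k = Real.exp (r * (k * h) / 2) := by
      rw [hγ, ← Real.exp_neg, ← Real.exp_nat_mul]; congr 1; ring
    rw [hinv]
    have ht : 0 ≤ (k : ℝ) * h := by positivity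
    set t : ℝ := k * h
    have h1 : r * t / 2 ≤ Real.exp (r * t / 2) := by
      have := Real.add_one_le_exp (r * t / 2); linarith
    have h2 : (r * t / 2) ^ 2 / 2 ≤ Real.exp (r * t / 2) := by
      have := Real.quadratic_le_exp_of_nonneg (by positivity : 0 ≤ r * t / 2)
      have : 0 ≤ r * t / 2 := by positivity
      linarith
    have e1 : 2 * c ^ 2 * t ^ 2 = 16 * c ^ 2 / r ^ 2 * ((r * t / 2) ^ 2 / 2) := by
      field_simp; ring
    have e2 : 8 * σ ^ 2 * t = 16 * σ ^ 2 / r * (r * t / 2) := by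
      field_simp; ring
    rw [e1, e2, hK, add_mul]
    exact add_le_add (mul_le_mul_of_nonneg_left h2 (by positivity))
      (mul_le_mul_of_nonneg_left h1 (by positivity))

end Risk

/-! ### Averages over random permutations -/

instance (n : ℕ) : DiscreteMeasurableSpace (Equiv.Perm (Fin n)) := ⟨fun _ => trivial⟩

section Permutation

variable {n : ℕ} {κ : Measure ℝ} [IsProbabilityMeasure κ]

lemma measurePreserving_comp_perm (p : Equiv.Perm (Fin n)) :
    MeasurePreserving (fun y : Fin n → ℝ => y ∘ p) (Measure.pi fun _ => κ)
      (Measure.pi fun _ => κ) := by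
  have h := measurePreserving_piCongrLeft (α := fun _ : Fin n => ℝ) (fun _ => κ) p.symm
  convert! h using 1
  funext y i
  have := Equiv.piCongrLeft_apply_apply (fun _ : Fin n => ℝ) p.symm y (p i)
  simp only [Equiv.symm_apply_apply] at this
  exact this.symm

/-- Functions of disjoint sets of coordinates are independent under a product measure. -/
lemma indepFun_of_disjoint_coords {f g : (Fin n → ℝ) → ℝ} (hf : Measurable f) (hg : Measurable g)
    {s t : Finset (Fin n)} (hst : Disjoint s t) (hfs : ∀ y y', (∀ i ∈ s, y i = y' i) → f y = f y')
    (hgt : ∀ y y', (∀ i ∈ t, y i = y' i) → g y = g y') :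
    IndepFun f g (Measure.pi fun _ : Fin n => κ) := by
  have hi : iIndepFun (fun (i : Fin n) (y : Fin n → ℝ) => y i) (Measure.pi fun _ : Fin n => κ) :=
    iIndepFun_pi (X := fun _ x => x) fun _ => aemeasurable_id
  let ext (s : Finset (Fin n)) (w : s → ℝ) (i : Fin n) : ℝ := if hi : i ∈ s then w ⟨i, hi⟩ else 0
  have hext : ∀ s, Measurable (ext s) := by
    intro s
    refine measurable_pi_lambda _ fun i => ?_
    simp only [ext]
    split_ifs <;> fun_prop
  have h := (hi.indepFun_finset s t hst measurable_pi_apply).comp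
    (hf.comp (hext s)) (hg.comp (hext t))
  convert! h using 1
  · funext y
    exact hfs _ _ fun i hi => by simp [ext, hi]
  · funext y
    exact hgt _ _ fun i hi => by simp [ext, hi]

lemma integral_comp_perm (p : Equiv.Perm (Fin n)) {f : (Fin n → ℝ) → ℝ} (hf : Measurable f) :
    ∫ y, f (y ∘ p) ∂(Measure.pi fun _ : Fin n => κ) = ∫ y, f y ∂(Measure.pi fun _ => κ) := by
  have h := measurePreserving_comp_perm (κ := κ) p
  nth_rw 2 [← h.map_eq]
  rw [integral_map h.measurable.aemeasurable hf.aestronglyMeasurable]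

/-- Hoeffding's variance bound for the symmetrization of a function of `m` of `n` independent
coordinates. -/
lemma integral_sum_perm_sq_le {m : ℕ} (hm : 0 < m) (hmn : m ≤ n) {f : (Fin n → ℝ) → ℝ}
    (hf : Measurable f) (hL : MemLp f 2 (Measure.pi fun _ => κ))
    (h0 : ∫ y, f y ∂(Measure.pi fun _ => κ) = 0)
    (hdep : ∀ y y' : Fin n → ℝ, (∀ i : Fin n, (i : ℕ) < m → y i = y' i) → f y = f y') :
    ∫ y, (∑ p : Equiv.Perm (Fin n), f (y ∘ p)) ^ 2 ∂(Measure.pi fun _ => κ) ≤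
      (n.factorial : ℝ) ^ 2 * (((n / m : ℕ) : ℝ)⁻¹ * ∫ y, f y ^ 2 ∂(Measure.pi fun _ => κ)) := by
  set P : Measure (Fin n → ℝ) := Measure.pi fun _ => κ with hP
  have hne : NeZero n := ⟨by omega⟩
  set K : ℕ := n / m with hK
  have hKpos : 0 < K := Nat.div_pos hmn hm
  have hKm : K * m ≤ n := Nat.div_mul_le_self n m
  -- Cyclic shifts carrying the first `m` coordinates onto the `j`-th block of length `m`; for `j <
  -- K` there is no wrap-around.
  let rot (j : ℕ) : Equiv.Perm (Fin n) := Equiv.addRight (Fin.ofNat n (j * m))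
  have hrot : ∀ j < K, ∀ i : Fin n, (i : ℕ) < m → ((rot j i : Fin n) : ℕ) = i + j * m := by
    intro j hj i hi
    have h1 : (j + 1) * m ≤ K * m := Nat.mul_le_mul_right m hj
    have h2 : i + j * m < n := by rw [add_mul, one_mul] at h1; omega
    simp only [rot, Equiv.coe_addRight, Fin.val_add, Fin.ofNat]
    rw [Nat.mod_eq_of_lt (by omega : j * m < n), Nat.mod_eq_of_lt h2]
  have hmp := measurePreserving_comp_perm (n := n) (κ := κ)
  have hLp : ∀ p : Equiv.Perm (Fin n), MemLp (fun y : Fin n → ℝ => f (y ∘ p)) 2 P := fun p =>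
    hL.comp_measurePreserving (hmp p)
  have hmeas : ∀ p : Equiv.Perm (Fin n), Measurable fun y : Fin n → ℝ => f (y ∘ p) := fun p =>
    hf.comp (hmp p).measurable
  -- A sum of `K` centred functions of disjoint blocks, hence independent: its second moment is `K`,
  -- not `K²`, times that of `f`.
  let Wf : (Fin n → ℝ) → ℝ := ∑ j ∈ Finset.range K, fun y => f (y ∘ rot j)
  have hWL : MemLp Wf 2 P := memLp_finsetSum' _ fun j _ => hLp (rot j)
  have hWm : Measurable Wf := by
    have : Wf = fun y => ∑ j ∈ Finset.range K, f (y ∘ rot j) := by funext y; simp [Wf]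
    rw [this]
    exact Finset.measurable_sum _ fun j _ => hmeas (rot j)
  let blk (j : ℕ) : Finset (Fin n) := Finset.univ.filter fun i => j * m ≤ i ∧ (i : ℕ) < (j + 1) * m
  have hblk : ∀ j < K, ∀ y y' : Fin n → ℝ, (∀ i ∈ blk j, y i = y' i) →
      f (y ∘ rot j) = f (y' ∘ rot j) := by
    intro j hj y y' hyy
    refine hdep _ _ fun i hi => hyy _ ?_
    simp only [blk, Finset.mem_filter, Finset.mem_univ, true_and]
    rw [hrot j hj i hi, add_mul, one_mul]
    omega
  have hdisj : ∀ i j, i < j → Disjoint (blk i) (blk j) := by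
    intro i j hij
    rw [Finset.disjoint_left]
    intro a ha hb
    simp only [blk, Finset.mem_filter, Finset.mem_univ, true_and] at ha hb
    have : (i + 1) * m ≤ j * m := Nat.mul_le_mul_right m hij
    omega
  have hindep : ∀ i ∈ Finset.range K, ∀ j ∈ Finset.range K, i ≠ j →
      IndepFun (fun y : Fin n → ℝ => f (y ∘ rot i)) (fun y => f (y ∘ rot j)) P := by
    intro i hi j hj hij
    refine indepFun_of_disjoint_coords (hmeas _) (hmeas _) (s := blk i) (t := blk j) ?_
      (hblk i (Finset.mem_range.1 hi)) (hblk j (Finset.mem_range.1 hj))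
    rcases lt_or_gt_of_ne hij with h | h
    · exact hdisj i j h
    · exact (hdisj j i h).symm
  have hmean : ∀ p : Equiv.Perm (Fin n), ∫ y, f (y ∘ p) ∂P = 0 := fun p => by
    rw [integral_comp_perm p hf, h0]
  have hWsq : ∫ y, Wf y ^ 2 ∂P = K * ∫ y, f y ^ 2 ∂P := by
    have hvar : Var[Wf; P] = ∑ j ∈ Finset.range K, Var[fun y => f (y ∘ rot j); P] :=
      IndepFun.variance_sum (fun j _ => hLp (rot j)) hindep
    have hW0 : ∫ y, Wf y ∂P = 0 := by
      simp only [Wf, Finset.sum_apply]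
      rw [integral_finsetSum _ fun j _ => (hLp (rot j)).integrable (by norm_num)]
      simp [hmean]
    rw [variance_of_integral_eq_zero hWL.aemeasurable hW0] at hvar
    rw [hvar, Finset.sum_congr rfl (g := fun _ => ∫ y, f y ^ 2 ∂P)]
    · simp
    · intro j _
      rw [variance_of_integral_eq_zero (hLp _).aemeasurable (hmean _)]
      exact integral_comp_perm (rot j) (hf.pow_const 2)
  -- Multiplication by `rot j` is a bijection of the symmetric group, so each block contributes the
  -- same full sum.
  have hsumW : ∀ y : Fin n → ℝ, (K : ℝ) * ∑ p : Equiv.Perm (Fin n), f (y ∘ p) =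
      ∑ p : Equiv.Perm (Fin n), Wf (y ∘ p) := by
    intro y
    simp only [Wf, Finset.sum_apply]
    have hshift : ∀ j, ∑ p : Equiv.Perm (Fin n), f ((y ∘ p) ∘ rot j) =
        ∑ p : Equiv.Perm (Fin n), f (y ∘ p) := fun j =>
      Fintype.sum_equiv (Equiv.mulRight (rot j)) _ _ fun p => rfl
    rw [Finset.sum_comm]
    simp only [hshift, Finset.sum_const, Finset.card_range, nsmul_eq_mul]
  have hWLp : ∀ p : Equiv.Perm (Fin n), MemLp (fun y : Fin n → ℝ => Wf (y ∘ p)) 2 P := fun p =>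
    hWL.comp_measurePreserving (hmp p)
  have hfac : (Finset.univ : Finset (Equiv.Perm (Fin n))).card = n.factorial := by
    rw [Finset.card_univ, Fintype.card_perm, Fintype.card_fin]
  -- Cauchy–Schwarz over the `n!` permutations, each of which leaves the second moment of `Wf`
  -- unchanged.
  have hmain : (K : ℝ) ^ 2 * ∫ y, (∑ p : Equiv.Perm (Fin n), f (y ∘ p)) ^ 2 ∂P ≤
      (n.factorial : ℝ) ^ 2 * (K * ∫ y, f y ^ 2 ∂P) := by
    rw [← integral_const_mul]
    calc ∫ y, (K : ℝ) ^ 2 * (∑ p : Equiv.Perm (Fin n), f (y ∘ p)) ^ 2 ∂P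
        ≤ ∫ y, (n.factorial : ℝ) * ∑ p : Equiv.Perm (Fin n), Wf (y ∘ p) ^ 2 ∂P := by
          refine integral_mono ?_ ?_ fun y => ?_
          · exact ((memLp_finsetSum _ fun p _ => hLp p).integrable_sq).const_mul _
          · exact (integrable_finsetSum _ fun p _ => (hWLp p).integrable_sq).const_mul _
          · show (K : ℝ) ^ 2 * (∑ p : Equiv.Perm (Fin n), f (y ∘ p)) ^ 2 ≤ _
            rw [← mul_pow, hsumW, ← hfac]
            exact sq_sum_le_card_mul_sum_sq
      _ = _ := by
          rw [integral_const_mul, integral_finsetSum _ fun p _ => (hWLp p).integrable_sq]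
          rw [Finset.sum_congr rfl fun p _ => integral_comp_perm p (hWm.pow_const 2), hWsq]
          rw [Finset.sum_const, hfac, nsmul_eq_mul]
          ring
  have hK0 : (0 : ℝ) < K := by exact_mod_cast hKpos
  have : (n.factorial : ℝ) ^ 2 * ((K : ℝ)⁻¹ * ∫ y, f y ^ 2 ∂P) =
      ((K : ℝ) ^ 2)⁻¹ * ((n.factorial : ℝ) ^ 2 * (K * ∫ y, f y ^ 2 ∂P)) := by
    field_simp
  rw [this, le_inv_mul_iff₀ (by positivity)]
  exact hmain

end Permutation

/-! ### Averages over independently sampled permutations -/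

section Sample

variable {Ω : Type*} [MeasurableSpace Ω] {μ : Measure Ω} [IsProbabilityMeasure μ]

/-- Integration over an independent pair of which one member takes finitely many values. -/
lemma integral_finite_indep {E A : Type*} [MeasurableSpace E] [Fintype A] [MeasurableSpace A]
    [MeasurableSingletonClass A] {V : Ω → E} {T : Ω → A} (hV : Measurable V) (hT : Measurable T)
    (hind : IndepFun V T μ) {H : A → E → ℝ} (hH : ∀ a, Measurable (H a))
    (hint : ∀ a, Integrable (H a) (μ.map V)) :
    Integrable (fun ω => H (T ω) (V ω)) μ ∧
    ∫ ω, H (T ω) (V ω) ∂μ = ∑ a, μ.real {ω | T ω = a} * ∫ y, H a y ∂(μ.map V) := by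
  classical
  have hset : ∀ a, MeasurableSet {ω | T ω = a} := fun a => hT (measurableSet_singleton a)
  have hVint : ∀ a, Integrable (fun ω => H a (V ω)) μ := fun a =>
    (integrable_map_measure (hH a).aestronglyMeasurable hV.aemeasurable).1 (hint a)
  have hdec : (fun ω => H (T ω) (V ω)) =
      fun ω => ∑ a, H a (V ω) * ({a} : Set A).indicator (fun _ => (1 : ℝ)) (T ω) := by
    funext ω
    rw [Finset.sum_eq_single (T ω)]
    · simp
    · intro a _ ha
      rw [Set.indicator_of_notMem (by simpa using ha.symm), mul_zero]
    · simp
  have him : ∀ a, Measurable (({a} : Set A).indicator fun _ => (1 : ℝ)) := fun a =>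
    measurable_const.indicator (measurableSet_singleton a)
  have hii : ∀ a, Integrable (fun ω => ({a} : Set A).indicator (fun _ => (1 : ℝ)) (T ω)) μ := by
    intro a
    refine Integrable.of_bound ((him a).comp hT).aestronglyMeasurable 1 (ae_of_all _ fun ω => ?_)
    by_cases h : T ω ∈ ({a} : Set A) <;> simp [h]
  have hindep : ∀ a, IndepFun (fun ω => H a (V ω))
      (fun ω => ({a} : Set A).indicator (fun _ => (1 : ℝ)) (T ω)) μ := fun a =>
    hind.comp (hH a) (him a)
  have hpi : ∀ a, Integrable (fun ω => H a (V ω) *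
      ({a} : Set A).indicator (fun _ => (1 : ℝ)) (T ω)) μ := fun a =>
    (hindep a).integrable_mul (hVint a) (hii a)
  rw [hdec]
  refine ⟨integrable_finsetSum _ fun a _ => hpi a, ?_⟩
  rw [integral_finsetSum _ fun a _ => hpi a]
  refine Finset.sum_congr rfl fun a _ => ?_
  rw [(hindep a).integral_fun_mul_eq_mul_integral (hVint a).aestronglyMeasurable
    (hii a).aestronglyMeasurable, integral_map hV.aemeasurable (hH a).aestronglyMeasurable,
    mul_comm]
  congr 1
  rw [← integral_indicator_one (hset a)]
  rfl

/-- The average of a function over permutations of a vector. -/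
def permMean {n a : ℕ} (p : Fin a → Equiv.Perm (Fin n)) (f : (Fin n → ℝ) → ℝ) (y : Fin n → ℝ) :
    ℝ := (a : ℝ)⁻¹ * ∑ k, f (y ∘ p k)

variable {n a : ℕ} {π : Fin a → Ω → Equiv.Perm (Fin n)} {V : Ω → Fin n → ℝ} {κ : Measure ℝ}
  [IsProbabilityMeasure κ]

lemma integral_comp_uniform (hV : Measurable V) (hlaw : μ.map V = Measure.pi fun _ => κ)
    {T : Ω → Equiv.Perm (Fin n)} (hT : Measurable T)
    (hunif : ∀ p, μ {ω | T ω = p} = (n.factorial : ℝ≥0∞)⁻¹)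
    (hind : IndepFun V T μ) {g : (Fin n → ℝ) → ℝ} (hg : Measurable g)
    (hgi : Integrable g (Measure.pi fun _ => κ)) :
    Integrable (fun ω => g (V ω ∘ T ω)) μ ∧
    ∫ ω, g (V ω ∘ T ω) ∂μ = ∫ y, g y ∂(Measure.pi fun _ => κ) := by
  have hmp := measurePreserving_comp_perm (n := n) (κ := κ)
  have h := integral_finite_indep hV hT hind (H := fun p y => g (y ∘ p))
    (fun p => hg.comp (hmp p).measurable) (fun p => by
      rw [hlaw]; exact (hmp p).integrable_comp_of_integrable hgi)
  refine ⟨h.1, h.2.trans ?_⟩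
  rw [hlaw]
  simp only [integral_comp_perm _ hg]
  rw [← Finset.sum_mul]
  have : ∀ p, μ.real {ω | T ω = p} = (n.factorial : ℝ)⁻¹ := fun p => by
    rw [measureReal_def, hunif]; simp
  simp only [this, Finset.sum_const, Finset.card_univ, Fintype.card_perm, Fintype.card_fin,
    nsmul_eq_mul]
  rw [mul_inv_cancel₀ (by positivity), one_mul]

/-- Expand the square into `a²` pairs. The `a` diagonal pairs give `1 / a`; an off-diagonal pair
consists of independent uniform permutations, so its expectation is the second moment of the full
symmetrization, bounded by `integral_sum_perm_sq_le`. -/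
lemma integral_permMean_sq_le (ha : 0 < a) (hV : Measurable V)
    (hlaw : μ.map V = Measure.pi fun _ => κ) (hπ : ∀ k, Measurable (π k))
    (hunif : ∀ k p, μ {ω | π k ω = p} = (n.factorial : ℝ≥0∞)⁻¹) (hii : iIndepFun π μ)
    (hind : IndepFun V (fun ω k => π k ω) μ) {m : ℕ} (hm : 0 < m) (hmn : m ≤ n)
    {f : (Fin n → ℝ) → ℝ} (hf : Measurable f) (hL : MemLp f 2 (Measure.pi fun _ => κ))
    (h0 : ∫ y, f y ∂(Measure.pi fun _ => κ) = 0)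
    (hdep : ∀ y y' : Fin n → ℝ, (∀ i : Fin n, (i : ℕ) < m → y i = y' i) → f y = f y') :
    Integrable (fun ω => permMean (fun k => π k ω) f (V ω) ^ 2) μ ∧
    ∫ ω, permMean (fun k => π k ω) f (V ω) ^ 2 ∂μ ≤
      ((a : ℝ)⁻¹ + ((n / m : ℕ) : ℝ)⁻¹) * ∫ y, f y ^ 2 ∂(Measure.pi fun _ => κ) := by
  set P : Measure (Fin n → ℝ) := Measure.pi fun _ => κ with hP
  have hmp := measurePreserving_comp_perm (n := n) (κ := κ)
  have hLp : ∀ p : Equiv.Perm (Fin n), MemLp (fun y : Fin n → ℝ => f (y ∘ p)) 2 P := fun p =>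
    hL.comp_measurePreserving (hmp p)
  have hmeas : ∀ p : Equiv.Perm (Fin n), Measurable fun y : Fin n → ℝ => f (y ∘ p) := fun p =>
    hf.comp (hmp p).measurable
  have hindk : ∀ k, IndepFun V (π k) μ := fun k =>
    hind.comp measurable_id (measurable_pi_apply k)
  have hindkl : ∀ k l, IndepFun V (fun ω => (π k ω, π l ω)) μ := fun k l =>
    hind.comp measurable_id ((measurable_pi_apply k).prodMk (measurable_pi_apply l))
  have hdiag : ∀ k, ∫ ω, f (V ω ∘ π k ω) * f (V ω ∘ π k ω) ∂μ = ∫ y, f y ^ 2 ∂P := by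
    intro k
    rw [← (integral_comp_uniform hV hlaw (hπ k) (hunif k) (hindk k) (hf.pow_const 2)
      hL.integrable_sq).2]
    simp only [sq]
  have hpair : ∀ k l, Integrable (fun ω => f (V ω ∘ π k ω) * f (V ω ∘ π l ω)) μ ∧
      ∫ ω, f (V ω ∘ π k ω) * f (V ω ∘ π l ω) ∂μ =
        ∑ q : Equiv.Perm (Fin n) × Equiv.Perm (Fin n), μ.real {ω | (π k ω, π l ω) = q} *
          ∫ y, f (y ∘ q.1) * f (y ∘ q.2) ∂P := by
    intro k l
    have h := integral_finite_indep hV ((hπ k).prodMk (hπ l)) (hindkl k l)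
      (H := fun q y => f (y ∘ q.1) * f (y ∘ q.2))
      (fun q => (hmeas q.1).mul (hmeas q.2))
      (fun q => by rw [hlaw]; exact (hLp q.1).integrable_mul (hLp q.2))
    rw [hlaw] at h
    exact h
  have hoff : ∀ k l, k ≠ l → ∫ ω, f (V ω ∘ π k ω) * f (V ω ∘ π l ω) ∂μ ≤
      ((n / m : ℕ) : ℝ)⁻¹ * ∫ y, f y ^ 2 ∂P := by
    intro k l hkl
    have hprob : ∀ q : Equiv.Perm (Fin n) × Equiv.Perm (Fin n),
        μ.real {ω | (π k ω, π l ω) = q} = ((n.factorial : ℝ) ^ 2)⁻¹ := by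
      intro q
      have h1 := (hii.indepFun hkl).measure_inter_preimage_eq_mul {q.1} {q.2}
        (measurableSet_singleton _) (measurableSet_singleton _)
      have h2 : {ω | (π k ω, π l ω) = q} = π k ⁻¹' {q.1} ∩ π l ⁻¹' {q.2} := by
        ext ω
        simp [Prod.ext_iff]
      rw [measureReal_def, h2, h1]
      have e1 : μ (π k ⁻¹' {q.1}) = (n.factorial : ℝ≥0∞)⁻¹ := hunif k q.1
      have e2 : μ (π l ⁻¹' {q.2}) = (n.factorial : ℝ≥0∞)⁻¹ := hunif l q.2
      rw [e1, e2]
      simp [sq]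
    rw [(hpair k l).2]
    simp only [hprob]
    rw [← Finset.mul_sum, inv_mul_le_iff₀ (by positivity), ← integral_finsetSum _ fun q _ =>
      (hLp q.1).integrable_mul (hLp q.2)]
    refine le_trans (le_of_eq ?_) (integral_sum_perm_sq_le hm hmn hf hL h0 hdep)
    congr 1
    funext y
    rw [sq, Finset.sum_mul_sum, ← Finset.univ_product_univ, Finset.sum_product]
  have hexp : ∀ ω, permMean (fun k => π k ω) f (V ω) ^ 2 =
      ((a : ℝ)⁻¹) ^ 2 * ∑ k, ∑ l, f (V ω ∘ π k ω) * f (V ω ∘ π l ω) := by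
    intro ω
    rw [permMean, mul_pow, sq (∑ k, _), Finset.sum_mul_sum]
  simp only [hexp]
  have hI : Integrable (fun ω => ∑ k, ∑ l, f (V ω ∘ π k ω) * f (V ω ∘ π l ω)) μ :=
    integrable_finsetSum _ fun k _ => integrable_finsetSum _ fun l _ => (hpair k l).1
  refine ⟨hI.const_mul _, ?_⟩
  rw [integral_const_mul, integral_finsetSum _ fun k _ =>
    integrable_finsetSum _ fun l _ => (hpair k l).1]
  have hK0 : 0 ≤ ((n / m : ℕ) : ℝ)⁻¹ * ∫ y, f y ^ 2 ∂P :=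
    mul_nonneg (by positivity) (integral_nonneg fun y => sq_nonneg _)
  have hrow : ∀ k, ∫ ω, ∑ l, f (V ω ∘ π k ω) * f (V ω ∘ π l ω) ∂μ ≤
      ∫ y, f y ^ 2 ∂P + a * (((n / m : ℕ) : ℝ)⁻¹ * ∫ y, f y ^ 2 ∂P) := by
    intro k
    rw [integral_finsetSum _ fun l _ => (hpair k l).1]
    calc _ ≤ ∑ l, ((if l = k then ∫ y, f y ^ 2 ∂P else 0) +
          ((n / m : ℕ) : ℝ)⁻¹ * ∫ y, f y ^ 2 ∂P) := by
          refine Finset.sum_le_sum fun l _ => ?_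
          split_ifs with h
          · rw [h, hdiag]; linarith
          · rw [zero_add]; exact hoff k l (Ne.symm h)
      _ = _ := by
          rw [Finset.sum_add_distrib]
          simp
  have ha0 : (0 : ℝ) < a := by exact_mod_cast ha
  calc _ ≤ ((a : ℝ)⁻¹) ^ 2 * ∑ _k : Fin a, (∫ y, f y ^ 2 ∂P +
        a * (((n / m : ℕ) : ℝ)⁻¹ * ∫ y, f y ^ 2 ∂P)) :=
        mul_le_mul_of_nonneg_left (Finset.sum_le_sum fun k _ => hrow k) (by positivity)
    _ = _ := by
        rw [Finset.sum_const, Finset.card_univ, Fintype.card_fin, nsmul_eq_mul]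
        field_simp

/-- The mean over permutations of a function of the first `m` coordinates is close to its
expectation. -/
lemma integral_abs_permMean_sub_le (ha : 0 < a) (hV : Measurable V)
    (hlaw : μ.map V = Measure.pi fun _ => κ) (hπ : ∀ k, Measurable (π k))
    (hunif : ∀ k p, μ {ω | π k ω = p} = (n.factorial : ℝ≥0∞)⁻¹) (hii : iIndepFun π μ)
    (hind : IndepFun V (fun ω k => π k ω) μ) {m : ℕ} (hm : 0 < m) (hmn : m ≤ n)
    {f : (Fin n → ℝ) → ℝ} (hf : Measurable f) (hL : MemLp f 2 (Measure.pi fun _ => κ))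
    (hdep : ∀ y y' : Fin n → ℝ, (∀ i : Fin n, (i : ℕ) < m → y i = y' i) → f y = f y')
    {C : ℝ} (hC : ∫ y, f y ^ 2 ∂(Measure.pi fun _ => κ) ≤ C) :
    Integrable (fun ω => |permMean (fun k => π k ω) f (V ω) -
      ∫ y, f y ∂(Measure.pi fun _ => κ)|) μ ∧
    ∫ ω, |permMean (fun k => π k ω) f (V ω) - ∫ y, f y ∂(Measure.pi fun _ => κ)| ∂μ ≤
      √(((a : ℝ)⁻¹ + ((n / m : ℕ) : ℝ)⁻¹) * C) := by
  set P : Measure (Fin n → ℝ) := Measure.pi fun _ => κ with hP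
  set e : ℝ := ∫ y, f y ∂P with he
  have hfi : Integrable f P := hL.integrable (by norm_num)
  have hLc : MemLp (fun y => f y - e) 2 P := hL.sub (memLp_const e)
  have hc0 : ∫ y, (f y - e) ∂P = 0 := by
    rw [integral_sub hfi (integrable_const e)]; simp [he]
  have ha0 : (0 : ℝ) < a := by exact_mod_cast ha
  have hcen : ∀ ω, permMean (fun k => π k ω) (fun y => f y - e) (V ω) =
      permMean (fun k => π k ω) f (V ω) - e := by
    intro ω
    simp only [permMean, Finset.sum_sub_distrib, Finset.sum_const, Finset.card_univ,
      Fintype.card_fin, nsmul_eq_mul]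
    field_simp
  have hsq := integral_permMean_sq_le ha hV hlaw hπ hunif hii hind hm hmn (hf.sub_const e) hLc hc0
    (fun y y' h => by rw [hdep y y' h])
  simp only [hcen] at hsq
  have hvar : ∫ y, (f y - e) ^ 2 ∂P ≤ C := by
    have h1 := variance_le_expectation_sq (μ := P) hf.aestronglyMeasurable
    rw [variance_eq_integral hf.aemeasurable] at h1
    exact h1.trans hC
  have hindk : ∀ k, IndepFun V (π k) μ := fun k =>
    hind.comp measurable_id (measurable_pi_apply k)
  have hI : Integrable (fun ω => permMean (fun k => π k ω) f (V ω) - e) μ := by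
    refine Integrable.sub ?_ (integrable_const e)
    refine (integrable_finsetSum _ fun k _ => ?_).const_mul _
    exact (integral_comp_uniform hV hlaw (hπ k) (hunif k) (hindk k) hf hfi).1
  refine ⟨hI.abs, Real.le_sqrt_of_sq_le ?_⟩
  have hL2 : MemLp (fun ω => permMean (fun k => π k ω) f (V ω) - e) 2 μ :=
    (memLp_two_iff_integrable_sq hI.aestronglyMeasurable).2 hsq.1
  -- Jensen's inequality, read off from the nonnegativity of a variance.
  have hjen : (∫ ω, |permMean (fun k => π k ω) f (V ω) - e| ∂μ) ^ 2 ≤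
      ∫ ω, (permMean (fun k => π k ω) f (V ω) - e) ^ 2 ∂μ := by
    have h1 := variance_nonneg (fun ω => |permMean (fun k => π k ω) f (V ω) - e|) μ
    have hab : MemLp (fun ω => |permMean (fun k => π k ω) f (V ω) - e|) 2 μ := hL2.abs
    rw [variance_eq_sub hab] at h1
    simp only [Pi.pow_apply, sq_abs] at h1
    linarith
  refine hjen.trans (hsq.2.trans ?_)
  exact mul_le_mul_of_nonneg_left hvar (by positivity)

end Sample

/-! ### Brackets for monotone families -/

/-- A monotone family over an uncountable set then has its infimum along a sequence, which keeps it
measurable and open to dominated convergence. The sequence is constant if the infimum is attained.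
-/
lemma exists_antitone_seq_coinitial {s : Set ℝ} (hne : s.Nonempty) (hb : BddBelow s) :
    ∃ a : ℕ → ℝ, Antitone a ∧ (∀ l, a l ∈ s) ∧ ∀ x ∈ s, ∃ l, a l ≤ x := by
  by_cases h : sInf s ∈ s
  · exact ⟨fun _ => sInf s, antitone_const, fun _ => h, fun x hx => ⟨0, csInf_le hb hx⟩⟩
  · obtain ⟨a, ha, hlim, hmem⟩ := exists_seq_tendsto_sInf hne hb
    refine ⟨a, ha, hmem, fun x hx => ?_⟩
    have hlt : sInf s < x := lt_of_le_of_ne (csInf_le hb hx) fun e => h (e ▸ hx)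
    obtain ⟨l, hl⟩ := (hlim.eventually (gt_mem_nhds hlt)).exists
    exact ⟨l, hl.le⟩

lemma exists_monotone_seq_cofinal {s : Set ℝ} (hne : s.Nonempty) (hb : BddAbove s) :
    ∃ a : ℕ → ℝ, Monotone a ∧ (∀ l, a l ∈ s) ∧ ∀ x ∈ s, ∃ l, x ≤ a l := by
  obtain ⟨a, ha, hmem, hco⟩ := exists_antitone_seq_coinitial (s := -s) hne.neg hb.neg
  refine ⟨fun l => -a l, ha.neg, hmem, fun x hx => ?_⟩
  obtain ⟨l, hl⟩ := hco (-x) (by simpa using hx)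
  exact ⟨l, by linarith⟩

section Bracket

variable {Y : Type*} [MeasurableSpace Y] {P : Measure Y} {I : Set ℝ} {G : ℝ → Y → ℝ} {A : Y → ℝ}

/-- The brackets are the pointwise infimum and supremum over `s`; by dominated convergence their
means stay within `[a, b]`. The last clause lets them inherit the dependence on the first `m`
coordinates. -/
lemma exists_bracket (hI0 : BddBelow I) (hI1 : BddAbove I) (hG : ∀ ϑ ∈ I, Measurable (G ϑ))
    (hmono : ∀ y, MonotoneOn (fun ϑ => G ϑ y) I) (h0 : ∀ ϑ ∈ I, ∀ y, 0 ≤ G ϑ y)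
    (hA : ∀ ϑ ∈ I, ∀ y, G ϑ y ≤ A y) (hAi : Integrable A P) {s : Set ℝ} (hs : s ⊆ I)
    (hne : s.Nonempty) {a b : ℝ} (ha : ∀ ϑ ∈ s, a ≤ ∫ y, G ϑ y ∂P)
    (hb : ∀ ϑ ∈ s, ∫ y, G ϑ y ∂P ≤ b) :
    ∃ L U : Y → ℝ, Measurable L ∧ Measurable U ∧ (∀ y, 0 ≤ L y ∧ L y ≤ A y) ∧
      (∀ y, 0 ≤ U y ∧ U y ≤ A y) ∧ (∀ ϑ ∈ s, ∀ y, L y ≤ G ϑ y ∧ G ϑ y ≤ U y) ∧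
      a ≤ ∫ y, L y ∂P ∧ ∫ y, U y ∂P ≤ b ∧
      ∀ y y', (∀ ϑ ∈ I, G ϑ y = G ϑ y') → L y = L y' ∧ U y = U y' := by
  obtain ⟨p, hp, hps, hpc⟩ := exists_antitone_seq_coinitial hne (hI0.mono hs)
  obtain ⟨q, hq, hqs, hqc⟩ := exists_monotone_seq_cofinal hne (hI1.mono hs)
  have hbdp : ∀ y, BddBelow (Set.range fun l => G (p l) y) := fun y =>
    ⟨0, by rintro _ ⟨l, rfl⟩; exact h0 _ (hs (hps l)) y⟩
  have hbdq : ∀ y, BddAbove (Set.range fun l => G (q l) y) := fun y =>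
    ⟨A y, by rintro _ ⟨l, rfl⟩; exact hA _ (hs (hqs l)) y⟩
  have hbd : ∀ ϑ ∈ I, ∀ᵐ y ∂P, ‖G ϑ y‖ ≤ A y := fun ϑ hϑ => ae_of_all _ fun y => by
    rw [Real.norm_of_nonneg (h0 ϑ hϑ y)]; exact hA ϑ hϑ y
  have hlimp : Tendsto (fun l => ∫ y, G (p l) y ∂P) atTop (𝓝 (∫ y, ⨅ l, G (p l) y ∂P)) := by
    refine tendsto_integral_of_dominated_convergence A
      (fun l => (hG _ (hs (hps l))).aestronglyMeasurable) hAi (fun l => hbd _ (hs (hps l)))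
      (ae_of_all _ fun y => tendsto_atTop_ciInf (fun i j hij => ?_) (hbdp y))
    exact hmono y (hs (hps j)) (hs (hps i)) (hp hij)
  have hlimq : Tendsto (fun l => ∫ y, G (q l) y ∂P) atTop (𝓝 (∫ y, ⨆ l, G (q l) y ∂P)) := by
    refine tendsto_integral_of_dominated_convergence A
      (fun l => (hG _ (hs (hqs l))).aestronglyMeasurable) hAi (fun l => hbd _ (hs (hqs l)))
      (ae_of_all _ fun y => tendsto_atTop_ciSup (fun i j hij => ?_) (hbdq y))
    exact hmono y (hs (hqs i)) (hs (hqs j)) (hq hij)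
  refine ⟨fun y => ⨅ l, G (p l) y, fun y => ⨆ l, G (q l) y,
    Measurable.iInf fun l => hG _ (hs (hps l)), Measurable.iSup fun l => hG _ (hs (hqs l)),
    fun y => ⟨le_ciInf fun l => h0 _ (hs (hps l)) y,
      (ciInf_le (hbdp y) 0).trans (hA _ (hs (hps 0)) y)⟩,
    fun y => ⟨(h0 _ (hs (hqs 0)) y).trans (le_ciSup (hbdq y) 0),
      ciSup_le fun l => hA _ (hs (hqs l)) y⟩, fun ϑ hϑ y => ⟨?_, ?_⟩,
    ge_of_tendsto' hlimp fun l => ha _ (hps l), le_of_tendsto' hlimq fun l => hb _ (hqs l),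
    fun y y' h => ⟨?_, ?_⟩⟩
  · obtain ⟨l, hl⟩ := hpc ϑ hϑ
    exact (ciInf_le (hbdp y) l).trans (hmono y (hs (hps l)) (hs hϑ) hl)
  · obtain ⟨l, hl⟩ := hqc ϑ hϑ
    exact (hmono y (hs hϑ) (hs (hqs l)) hl).trans (le_ciSup (hbdq y) l)
  · exact iInf_congr fun l => h _ (hs (hps l))
  · exact iSup_congr fun l => h _ (hs (hqs l))

/-- A uniformly bounded monotone family has `N` brackets of size `C / N`. -/
lemma exists_brackets (hI0 : BddBelow I) (hI1 : BddAbove I) (hG : ∀ ϑ ∈ I, Measurable (G ϑ))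
    (hmono : ∀ y, MonotoneOn (fun ϑ => G ϑ y) I) (h0 : ∀ ϑ ∈ I, ∀ y, 0 ≤ G ϑ y)
    (hA : ∀ ϑ ∈ I, ∀ y, G ϑ y ≤ A y) (hA0 : ∀ y, 0 ≤ A y) (hAi : Integrable A P) {C : ℝ}
    (hC : ∫ y, A y ∂P ≤ C) {N : ℕ} (hN : 0 < N) :
    ∃ L U : ℕ → Y → ℝ, (∀ i, Measurable (L i)) ∧ (∀ i, Measurable (U i)) ∧
      (∀ i y, 0 ≤ L i y ∧ L i y ≤ A y) ∧ (∀ i y, 0 ≤ U i y ∧ U i y ≤ A y) ∧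
      (∀ ϑ ∈ I, ∃ i < N, (∀ y, L i y ≤ G ϑ y ∧ G ϑ y ≤ U i y) ∧
        ∫ y, U i y ∂P - ∫ y, L i y ∂P ≤ C / N) ∧
      ∀ i y y', (∀ ϑ ∈ I, G ϑ y = G ϑ y') → L i y = L i y' ∧ U i y = U i y' := by
  have hN0 : (0 : ℝ) < N := by exact_mod_cast hN
  -- Slicing by the mean rather than by `ϑ` makes continuity in `ϑ` unnecessary; empty slices get
  -- zero brackets.
  let s (i : ℕ) : Set ℝ := {ϑ ∈ I | i * (C / N) ≤ ∫ y, G ϑ y ∂P ∧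
    ∫ y, G ϑ y ∂P ≤ (i + 1) * (C / N)}
  have hex : ∀ i, ∃ L U : Y → ℝ, Measurable L ∧ Measurable U ∧ (∀ y, 0 ≤ L y ∧ L y ≤ A y) ∧
      (∀ y, 0 ≤ U y ∧ U y ≤ A y) ∧ (∀ ϑ ∈ s i, (∀ y, L y ≤ G ϑ y ∧ G ϑ y ≤ U y) ∧
        ∫ y, U y ∂P - ∫ y, L y ∂P ≤ C / N) ∧
      ∀ y y', (∀ ϑ ∈ I, G ϑ y = G ϑ y') → L y = L y' ∧ U y = U y' := by
    intro i
    rcases (s i).eq_empty_or_nonempty with he | hne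
    · refine ⟨0, 0, measurable_zero, measurable_zero, fun y => ⟨le_rfl, hA0 y⟩,
        fun y => ⟨le_rfl, hA0 y⟩, fun ϑ hϑ => ?_, fun _ _ _ => ⟨rfl, rfl⟩⟩
      rw [he] at hϑ
      exact hϑ.elim
    · obtain ⟨L, U, h1, h2, h3, h4, h5, h6, h7, h8⟩ := exists_bracket hI0 hI1 hG hmono h0 hA hAi
        (s := s i) (fun ϑ hϑ => hϑ.1) hne (fun ϑ hϑ => hϑ.2.1) (fun ϑ hϑ => hϑ.2.2)
      exact ⟨L, U, h1, h2, h3, h4, fun ϑ hϑ => ⟨h5 ϑ hϑ, by linarith⟩, h8⟩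
  choose L U h1 h2 h3 h4 h5 h6 using hex
  refine ⟨L, U, h1, h2, h3, h4, fun ϑ hϑ => ?_, h6⟩
  have hφ0 : 0 ≤ ∫ y, G ϑ y ∂P := integral_nonneg fun y => h0 ϑ hϑ y
  have hφC : ∫ y, G ϑ y ∂P ≤ C := by
    refine (integral_mono_of_nonneg (ae_of_all _ fun y => h0 ϑ hϑ y) hAi
      (ae_of_all _ fun y => hA ϑ hϑ y)).trans hC
  set φ := ∫ y, G ϑ y ∂P with hφ
  have hmem : ∃ i < N, (i : ℝ) * (C / N) ≤ φ ∧ φ ≤ (i + 1) * (C / N) := by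
    by_contra! hcon
    have hind : ∀ i : ℕ, i < N → (i + 1 : ℝ) * (C / N) < φ := by
      intro i
      induction i with
      | zero => intro hi; exact hcon 0 hi (by simpa using hφ0)
      | succ i ih =>
        intro hi
        refine hcon (i + 1) hi ?_
        push_cast
        exact (ih (by omega)).le
    have h := hind (N - 1) (by omega)
    have hcast : ((N - 1 : ℕ) : ℝ) + 1 = N := by
      rw [Nat.cast_sub hN]; simp
    rw [hcast, mul_div_cancel₀ _ hN0.ne'] at h
    linarith
  obtain ⟨i, hi, hi1, hi2⟩ := hmem
  exact ⟨i, hi, h5 i ϑ ⟨hϑ, hi1, hi2⟩⟩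

end Bracket

/-! ### The uniform law of large numbers -/

lemma edist_ennreal_zero (x : ℝ≥0∞) : edist x 0 = x := by
  induction x with
  | top => exact (ENNReal.edist_eq_top_iff _ _).2 ⟨ENNReal.top_ne_zero, Or.inl rfl⟩
  | coe a =>
    have h : edist (a : ℝ≥0∞) ((0 : ℝ≥0) : ℝ≥0∞) = edist a 0 := rfl
    rw [← ENNReal.coe_zero, h, edist_nndist, NNReal.nndist_zero_eq_val']

lemma permMean_mono {n a : ℕ} (p : Fin a → Equiv.Perm (Fin n)) {f g : (Fin n → ℝ) → ℝ}
    (h : ∀ y, f y ≤ g y) (y : Fin n → ℝ) : permMean p f y ≤ permMean p g y :=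
  mul_le_mul_of_nonneg_left (Finset.sum_le_sum fun _ _ => h _) (by positivity)

lemma permMean_sub {n a : ℕ} (p : Fin a → Equiv.Perm (Fin n)) (f g : (Fin n → ℝ) → ℝ)
    (y : Fin n → ℝ) : permMean p (fun y => f y - g y) y = permMean p f y - permMean p g y := by
  simp only [permMean, Finset.sum_sub_distrib, mul_sub]

lemma permMean_add_const {n a : ℕ} (ha : 0 < a) (p : Fin a → Equiv.Perm (Fin n))
    (f : (Fin n → ℝ) → ℝ) (b : ℝ) (y : Fin n → ℝ) :
    permMean p (fun y => f y + b) y = permMean p f y + b := by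
  have ha0 : (0 : ℝ) < a := by exact_mod_cast ha
  simp only [permMean, Finset.sum_add_distrib, Finset.sum_const, Finset.card_univ,
    Fintype.card_fin, nsmul_eq_mul, mul_add]
  field_simp

lemma integral_empiricalMeasure {u : ℝ} {h : ℝ≥0} (hh : 0 < h) {n a : ℕ}
    (p : Fin a → Equiv.Perm (Fin n)) (x : CadlagPath) {g : (Fin n → ℝ) → ℝ} (hg : Measurable g) :
    ∫ x', g (increments h n x') ∂(empiricalMeasure u h n a p x) =
      permMean p g (increments h n x) := by
  have hm : Measurable fun x' : CadlagPath => g (increments h n x') :=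
    hg.comp (measurable_increments h n)
  have hi : ∀ k ∈ Finset.univ, Integrable (fun x' : CadlagPath => g (increments h n x'))
      (Measure.dirac (quasiPath u h n (p k) x)) := fun k _ => by
    refine ⟨hm.aestronglyMeasurable, ?_⟩
    rw [HasFiniteIntegral, lintegral_dirac' _ hm.enorm]
    exact enorm_lt_top
  rw [empiricalMeasure, integral_smul_measure, integral_finsetSum_measure hi, permMean]
  simp only [integral_dirac' _ _ hm.stronglyMeasurable, increments_quasiPath hh]
  simp

section Uniform

variable {Ω : Type*} [MeasurableSpace Ω] {μ : Measure Ω} [IsProbabilityMeasure μ]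
  {n a : ℕ} {π : Fin a → Ω → Equiv.Perm (Fin n)} {V : Ω → Fin n → ℝ} {κ : Measure ℝ}
  [IsProbabilityMeasure κ]

/-- A quantitative uniform law for the means of the walk value over random permutations. -/
lemma exists_uniform_bound (ha : 0 < a) (hV : Measurable V)
    (hlaw : μ.map V = Measure.pi fun _ => κ) (hπ : ∀ k, Measurable (π k))
    (hunif : ∀ k p, μ {ω | π k ω = p} = (n.factorial : ℝ≥0∞)⁻¹) (hii : iIndepFun π μ)
    (hind : IndepFun V (fun ω k => π k ω) μ) {m l : ℕ} (hm : 0 < m) (hml : m ≤ l) (hln : l ≤ n)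
    {β u ϑbar : ℝ} (hβ : 0 ≤ β) (hβ1 : β ≤ 1) (hu : u ≤ ϑbar) {B D : ℝ}
    (hrise : Integrable (fun y => discountedRise β u 0 m (extendZero y) ^ 2)
      (Measure.pi fun _ : Fin n => κ))
    (hB : ∫ y, discountedRise β u 0 m (extendZero y) ^ 2 ∂(Measure.pi fun _ : Fin n => κ) ≤ B)
    (htail : Integrable (fun y => discountedRise β u m l (extendZero y) ^ 2)
      (Measure.pi fun _ : Fin n => κ))
    (hD : ∫ y, discountedRise β u m l (extendZero y) ^ 2 ∂(Measure.pi fun _ : Fin n => κ) ≤ D)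
    {N : ℕ} (hN : 0 < N) :
    ∃ R : Ω → ℝ, Integrable R μ ∧ (∀ ω, 0 ≤ R ω) ∧
      (∀ ω, ∀ ϑ ∈ Set.Icc u ϑbar,
        |permMean (fun k => π k ω) (fun y => walkValue β u l ϑ (extendZero y)) (V ω) -
          ∫ y, walkValue β u l ϑ (extendZero y) ∂(Measure.pi fun _ : Fin n => κ)| ≤ R ω) ∧
      ∫ ω, R ω ∂μ ≤ 2 * √D +
        2 * N * √(((a : ℝ)⁻¹ + ((n / m : ℕ) : ℝ)⁻¹) * (2 * B + 2 * (ϑbar - u) ^ 2)) +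
        √(2 * B + 2 * (ϑbar - u) ^ 2) / N := by
  set P : Measure (Fin n → ℝ) := Measure.pi fun _ => κ with hP
  set C : ℝ := 2 * B + 2 * (ϑbar - u) ^ 2 with hC
  set I : Set ℝ := Set.Icc u ϑbar with hI
  have hd0 : 0 ≤ ϑbar - u := sub_nonneg.2 hu
  have hext := measurable_extendZero n
  let T : (Fin n → ℝ) → ℝ := fun y => discountedRise β u m l (extendZero y)
  have hTm : Measurable T := (measurable_discountedRise β u m l).comp hext
  have hT0 : ∀ y, 0 ≤ T y := fun y => discountedRise_nonneg hβ u m l _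
  have hTL : MemLp T 2 P := (memLp_two_iff_integrable_sq hTm.aestronglyMeasurable).2 htail
  have hTi : Integrable T P := hTL.integrable (by norm_num)
  have jensen : ∀ f : (Fin n → ℝ) → ℝ, MemLp f 2 P → ∀ b, ∫ y, f y ^ 2 ∂P ≤ b →
      ∫ y, f y ∂P ≤ √b := by
    intro f hf b hb
    refine Real.le_sqrt_of_sq_le ?_
    have h1 := variance_nonneg f P
    rw [variance_eq_sub hf] at h1
    simp only [Pi.pow_apply] at h1
    linarith
  have hTint : ∫ y, T y ∂P ≤ √D := jensen T hTL D hD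
  -- Envelope of the shifted family `G` below; the constant covers the shift `ϑ - u`.
  let A : (Fin n → ℝ) → ℝ := fun y => discountedRise β u 0 m (extendZero y) + (ϑbar - u)
  have hrm : Measurable fun y : Fin n → ℝ => discountedRise β u 0 m (extendZero y) :=
    (measurable_discountedRise β u 0 m).comp hext
  have hrL : MemLp (fun y : Fin n → ℝ => discountedRise β u 0 m (extendZero y)) 2 P :=
    (memLp_two_iff_integrable_sq hrm.aestronglyMeasurable).2 hrise
  have hAL : MemLp A 2 P := hrL.add (memLp_const _)
  have hA0 : ∀ y, 0 ≤ A y := fun y => add_nonneg (discountedRise_nonneg hβ u 0 m _) hd0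
  have hAsq : ∫ y, A y ^ 2 ∂P ≤ C := by
    have hle : ∀ y, A y ^ 2 ≤ 2 * discountedRise β u 0 m (extendZero y) ^ 2 +
        2 * (ϑbar - u) ^ 2 := fun y => by
      have := sq_nonneg (discountedRise β u 0 m (extendZero y) - (ϑbar - u))
      simp only [A]
      nlinarith
    have hbi : Integrable (fun y : Fin n → ℝ => 2 * discountedRise β u 0 m (extendZero y) ^ 2 +
        2 * (ϑbar - u) ^ 2) P := (hrise.const_mul 2).add (integrable_const _)
    refine (integral_mono hAL.integrable_sq hbi hle).trans ?_
    rw [integral_add (hrise.const_mul 2) (integrable_const _), integral_const_mul, integral_const,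
      probReal_univ, one_smul]
    linarith
  have hAi : Integrable A P := hAL.integrable (by norm_num)
  let g (k : ℕ) (ϑ : ℝ) (y : Fin n → ℝ) : ℝ := walkValue β u k ϑ (extendZero y)
  have hgm : ∀ k ϑ, Measurable (g k ϑ) := fun k ϑ => (measurable_walkValue β u k ϑ).comp hext
  -- The shift makes the family monotone and nonnegative, and cancels in the difference of empirical
  -- and true mean.
  let G (ϑ : ℝ) (y : Fin n → ℝ) : ℝ := g m ϑ y + (ϑ - u)
  have hGm : ∀ ϑ, Measurable (G ϑ) := fun ϑ => (hgm m ϑ).add_const _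
  have hG0 : ∀ ϑ ∈ I, ∀ y, 0 ≤ G ϑ y := fun ϑ hϑ y =>
    add_nonneg (walkValue_nonneg u m ϑ _ hβ) (sub_nonneg.2 hϑ.1)
  have hGA : ∀ ϑ ∈ I, ∀ y, G ϑ y ≤ A y := fun ϑ hϑ y =>
    add_le_add (walkValue_le u m ϑ _ hβ) (sub_le_sub_right hϑ.2 u)
  have hGmono : ∀ y, MonotoneOn (fun ϑ => G ϑ y) I := fun y ϑ _ ϑ' _ hle => by
    have h1 : g m ϑ y + ϑ ≤ g m ϑ' y + ϑ' := walkValue_add_mono hβ hβ1 u m (extendZero y) hle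
    simp only [G]
    linarith
  obtain ⟨L, U, hLm, hUm, hLA, hUA, hcov, hdepLU⟩ := exists_brackets (P := P) (I := I) (G := G)
    bddBelow_Icc bddAbove_Icc (fun ϑ _ => hGm ϑ) hGmono hG0 hGA hA0 hAi (jensen A hAL C hAsq) hN
  have hGdep : ∀ y y' : Fin n → ℝ, (∀ i : Fin n, (i : ℕ) < m → y i = y' i) →
      ∀ ϑ ∈ I, G ϑ y = G ϑ y' := by
    intro y y' h ϑ _
    simp only [G, g]
    rw [walkValue_congr β u ϑ fun i hi => ?_]
    have hin : i < n := by omega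
    simpa [extendZero, hin] using h ⟨i, hin⟩ hi
  have hfL : ∀ f : (Fin n → ℝ) → ℝ, Measurable f → (∀ y, 0 ≤ f y ∧ f y ≤ A y) →
      MemLp f 2 P ∧ ∫ y, f y ^ 2 ∂P ≤ C := by
    intro f hf hfA
    have hfL : MemLp f 2 P := hAL.mono' hf.aestronglyMeasurable (ae_of_all _ fun y => by
      rw [Real.norm_of_nonneg (hfA y).1]; exact (hfA y).2)
    exact ⟨hfL, (integral_mono hfL.integrable_sq hAL.integrable_sq fun y =>
      pow_le_pow_left₀ (hfA y).1 (hfA y).2 2).trans hAsq⟩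
  let E (f : (Fin n → ℝ) → ℝ) (ω : Ω) : ℝ := |permMean (fun k => π k ω) f (V ω) - ∫ y, f y ∂P|
  set δ : ℝ := √(((a : ℝ)⁻¹ + ((n / m : ℕ) : ℝ)⁻¹) * C) with hδ
  have hE : ∀ f : (Fin n → ℝ) → ℝ, Measurable f → (∀ y, 0 ≤ f y ∧ f y ≤ A y) →
      (∀ y y', (∀ ϑ ∈ I, G ϑ y = G ϑ y') → f y = f y') →
      Integrable (E f) μ ∧ ∫ ω, E f ω ∂μ ≤ δ := by
    intro f hf hfA hdep
    exact integral_abs_permMean_sub_le ha hV hlaw hπ hunif hii hind hm (hml.trans hln) hf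
      (hfL f hf hfA).1 (fun y y' h => hdep y y' (hGdep y y' h)) (hfL f hf hfA).2
  have hEL := fun i => hE (L i) (hLm i) (hLA i) fun y y' h => (hdepLU i y y' h).1
  have hEU := fun i => hE (U i) (hUm i) (hUA i) fun y y' h => (hdepLU i y y' h).2
  have hE0 : ∀ f ω, 0 ≤ E f ω := fun f ω => abs_nonneg _
  have hindk : ∀ k, IndepFun V (π k) μ := fun k =>
    hind.comp measurable_id (measurable_pi_apply k)
  have hTk := fun k => integral_comp_uniform hV hlaw (hπ k) (hunif k) (hindk k) hTm hTi
  have hPTi : Integrable (fun ω => permMean (fun k => π k ω) T (V ω)) μ :=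
    (integrable_finsetSum _ fun k _ => (hTk k).1).const_mul _
  have ha0 : (0 : ℝ) < a := by exact_mod_cast ha
  have hPT : ∫ ω, permMean (fun k => π k ω) T (V ω) ∂μ = ∫ y, T y ∂P := by
    simp only [permMean]
    rw [integral_const_mul, integral_finsetSum _ fun k _ => (hTk k).1]
    simp only [fun k => (hTk k).2]
    rw [Finset.sum_const, Finset.card_univ, Fintype.card_fin, nsmul_eq_mul]
    field_simp
    rfl
  have hEi : ∀ i, Integrable (fun ω => E (L i) ω + E (U i) ω) μ := fun i =>
    (hEL i).1.add (hEU i).1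
  have hsumi : Integrable (fun ω => ∑ i ∈ Finset.range N, (E (L i) ω + E (U i) ω)) μ :=
    integrable_finsetSum _ fun i _ => hEi i
  have hs1 : Integrable (fun ω => permMean (fun k => π k ω) T (V ω) + ∫ y, T y ∂P) μ :=
    hPTi.add (integrable_const _)
  have hs2 : Integrable (fun ω => permMean (fun k => π k ω) T (V ω) + ∫ y, T y ∂P +
      ∑ i ∈ Finset.range N, (E (L i) ω + E (U i) ω)) μ := hs1.add hsumi
  -- Truncation error under both measures, the deviations of all brackets (summed instead of
  -- maximized), and the bracket size.
  refine ⟨fun ω => permMean (fun k => π k ω) T (V ω) + ∫ y, T y ∂P +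
    ∑ i ∈ Finset.range N, (E (L i) ω + E (U i) ω) + √C / N, ?_, ?_, ?_, ?_⟩
  · exact hs2.add (integrable_const _)
  · intro ω
    have h1 : 0 ≤ permMean (fun k => π k ω) T (V ω) :=
      mul_nonneg (by positivity) (Finset.sum_nonneg fun k _ => hT0 _)
    have h2 : 0 ≤ ∫ y, T y ∂P := integral_nonneg hT0
    have h3 : 0 ≤ ∑ i ∈ Finset.range N, (E (L i) ω + E (U i) ω) :=
      Finset.sum_nonneg fun i _ => add_nonneg (hE0 _ _) (hE0 _ _)
    positivity
  · intro ω ϑ hϑ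
    set p : Fin a → Equiv.Perm (Fin n) := fun k => π k ω
    have hgT : ∀ y, 0 ≤ g l ϑ y - g m ϑ y ∧ g l ϑ y - g m ϑ y ≤ T y := fun y =>
      walkValue_sub u hml ϑ (extendZero y) hβ
    have hGi : Integrable (G ϑ) P := ((hfL (G ϑ) (hGm ϑ) fun y =>
      ⟨hG0 ϑ hϑ y, hGA ϑ hϑ y⟩).1).integrable (by norm_num)
    have hgi : Integrable (g m ϑ) P := by
      have h := hGi.sub (integrable_const (ϑ - u))
      refine h.congr (ae_of_all _ fun y => ?_)
      simp [G]
    have hdi : Integrable (fun y => g l ϑ y - g m ϑ y) P :=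
      hTi.mono' ((hgm l ϑ).sub (hgm m ϑ)).aestronglyMeasurable (ae_of_all _ fun y => by
        rw [Real.norm_of_nonneg (hgT y).1]; exact (hgT y).2)
    have hgli : Integrable (g l ϑ) P := by
      refine (hdi.add hgi).congr (ae_of_all _ fun y => ?_)
      simp
    have e1 : permMean p (g l ϑ) (V ω) - permMean p (g m ϑ) (V ω) =
        permMean p (fun y => g l ϑ y - g m ϑ y) (V ω) := (permMean_sub p _ _ _).symm
    have e2 : ∫ y, g l ϑ y ∂P - ∫ y, g m ϑ y ∂P = ∫ y, (g l ϑ y - g m ϑ y) ∂P :=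
      (integral_sub hgli hgi).symm
    have a1 : permMean p (fun y => g l ϑ y - g m ϑ y) (V ω) ≤ permMean p T (V ω) :=
      permMean_mono p (fun y => (hgT y).2) _
    have a2 : 0 ≤ permMean p (fun y => g l ϑ y - g m ϑ y) (V ω) :=
      mul_nonneg (by positivity) (Finset.sum_nonneg fun k _ => (hgT _).1)
    have a3 : ∫ y, (g l ϑ y - g m ϑ y) ∂P ≤ ∫ y, T y ∂P :=
      integral_mono hdi hTi fun y => (hgT y).2
    have a4 : 0 ≤ ∫ y, (g l ϑ y - g m ϑ y) ∂P := integral_nonneg fun y => (hgT y).1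
    obtain ⟨i, hi, hbr, hsize⟩ := hcov ϑ hϑ
    have hLi : Integrable (L i) P := ((hfL _ (hLm i) (hLA i)).1).integrable (by norm_num)
    have hUi : Integrable (U i) P := ((hfL _ (hUm i) (hUA i)).1).integrable (by norm_num)
    have b1 : permMean p (G ϑ) (V ω) = permMean p (g m ϑ) (V ω) + (ϑ - u) :=
      permMean_add_const ha p _ _ _
    have b2 : ∫ y, G ϑ y ∂P = ∫ y, g m ϑ y ∂P + (ϑ - u) := by
      simp only [G]
      rw [integral_add hgi (integrable_const _), integral_const, probReal_univ, one_smul]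
    have b3 : permMean p (L i) (V ω) ≤ permMean p (G ϑ) (V ω) :=
      permMean_mono p (fun y => (hbr y).1) _
    have b4 : permMean p (G ϑ) (V ω) ≤ permMean p (U i) (V ω) :=
      permMean_mono p (fun y => (hbr y).2) _
    have b5 : ∫ y, L i y ∂P ≤ ∫ y, G ϑ y ∂P := integral_mono hLi hGi fun y => (hbr y).1
    have b6 : ∫ y, G ϑ y ∂P ≤ ∫ y, U i y ∂P := integral_mono hGi hUi fun y => (hbr y).2
    have c1 := abs_le.1 (le_refl (E (L i) ω))
    have c2 := abs_le.1 (le_refl (E (U i) ω))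
    have c3 : E (L i) ω + E (U i) ω ≤ ∑ i ∈ Finset.range N, (E (L i) ω + E (U i) ω) :=
      Finset.single_le_sum (f := fun i => E (L i) ω + E (U i) ω)
        (fun i _ => add_nonneg (hE0 _ _) (hE0 _ _)) (Finset.mem_range.2 hi)
    have c4 := hE0 (L i) ω
    have c5 := hE0 (U i) ω
    show |permMean p (g l ϑ) (V ω) - ∫ y, g l ϑ y ∂P| ≤ _
    refine abs_le.2 ⟨?_, ?_⟩
    · linarith [c1.1]
    · linarith [c2.2]
  · show ∫ ω, (permMean (fun k => π k ω) T (V ω) + ∫ y, T y ∂P +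
      ∑ i ∈ Finset.range N, (E (L i) ω + E (U i) ω) + √C / N) ∂μ ≤ _
    rw [integral_add hs2 (integrable_const _), integral_add hs1 hsumi, integral_add hPTi (integrable_const _),
      integral_finsetSum _ fun i _ => hEi i, hPT]
    simp only [integral_const, probReal_univ, one_smul]
    have hs : ∑ i ∈ Finset.range N, ∫ ω, (E (L i) ω + E (U i) ω) ∂μ ≤
        ∑ _i ∈ Finset.range N, (δ + δ) := by
      refine Finset.sum_le_sum fun i _ => ?_
      rw [integral_add (hEL i).1 (hEU i).1]
      exact add_le_add (hEL i).2 (hEU i).2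
    rw [Finset.sum_const, Finset.card_range, nsmul_eq_mul] at hs
    linarith

end Uniform

/-! ### Choice of the truncation level and of the number of brackets -/

section Asymptotics

variable {h : ℕ → ℝ≥0}

/-- The number of grid points used to truncate the discounted dividends. -/
def truncationLevel (h : ℕ → ℝ≥0) (n : ℕ) : ℕ := ⌈√((n : ℝ) / h n)⌉₊

lemma sqrt_div_mul (hpos : ∀ n, 0 < h n) (n : ℕ) :
    √((n : ℝ) / h n) * h n = √((n : ℝ) * h n) := by
  have hh : (0 : ℝ) < h n := hpos n
  have : (n : ℝ) * h n = (n / h n) * (h n : ℝ) ^ 2 := by field_simp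
  rw [this, Real.sqrt_mul (by positivity), Real.sqrt_sq hh.le]

lemma tendsto_sqrt_horizon (hlong : Tendsto (fun n : ℕ => (n : ℝ≥0) * h n) atTop atTop) :
    Tendsto (fun n : ℕ => √((n : ℝ) * h n)) atTop atTop := by
  refine Real.tendsto_sqrt_atTop.comp ?_
  have := NNReal.tendsto_coe_atTop.2 hlong
  simpa using this

lemma tendsto_truncationLevel_mul (hpos : ∀ n, 0 < h n)
    (hlong : Tendsto (fun n : ℕ => (n : ℝ≥0) * h n) atTop atTop) :
    Tendsto (fun n : ℕ => (truncationLevel h n : ℝ) * h n) atTop atTop := by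
  refine tendsto_atTop_mono (fun n => ?_) (tendsto_sqrt_horizon hlong)
  rw [← sqrt_div_mul hpos]
  exact mul_le_mul_of_nonneg_right (Nat.le_ceil _) (h n).2

lemma truncationLevel_pos (hpos : ∀ n, 0 < h n) {n : ℕ} (hn : 0 < n) :
    0 < truncationLevel h n := by
  have hh : (0 : ℝ) < h n := hpos n
  have : (0 : ℝ) < n := by exact_mod_cast hn
  exact Nat.ceil_pos.2 (Real.sqrt_pos.2 (by positivity))

/-- Since `√(n/h) √(n h) = n`, the bound `√(n h) ≥ 2 M` gives `M √(n/h) ≤ n / 2`; the rounding costs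
another `M ≤ n / 2`. -/
lemma tendsto_div_truncationLevel (hpos : ∀ n, 0 < h n)
    (hlong : Tendsto (fun n : ℕ => (n : ℝ≥0) * h n) atTop atTop) :
    Tendsto (fun n : ℕ => n / truncationLevel h n) atTop atTop := by
  refine tendsto_atTop.2 fun M => ?_
  filter_upwards [(tendsto_sqrt_horizon hlong).eventually_ge_atTop (2 * M),
    eventually_ge_atTop (2 * M), eventually_gt_atTop 0] with n h1 h2 h3
  rw [Nat.le_div_iff_mul_le (truncationLevel_pos hpos h3)]
  have hh : (0 : ℝ) < h n := hpos n
  have hs : 0 ≤ √((n : ℝ) / h n) := Real.sqrt_nonneg _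
  have hc : (truncationLevel h n : ℝ) ≤ √((n : ℝ) / h n) + 1 := (Nat.ceil_lt_add_one hs).le
  have h2' : (2 * M : ℝ) ≤ n := by exact_mod_cast h2
  have hprod : √((n : ℝ) / h n) * √((n : ℝ) * h n) = n := by
    rw [← Real.sqrt_mul (by positivity)]
    have : (n : ℝ) / h n * (n * h n) = (n : ℝ) ^ 2 := by field_simp
    rw [this, Real.sqrt_sq (by positivity)]
  have h4 := mul_le_mul_of_nonneg_left h1 hs
  rw [hprod] at h4
  have h5 : (M : ℝ) * truncationLevel h n ≤ M * (√((n : ℝ) / h n) + 1) :=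
    mul_le_mul_of_nonneg_left hc (by positivity)
  have : (M : ℝ) * truncationLevel h n ≤ n := by linarith
  exact_mod_cast this

lemma tendsto_inv_of_div {α : ℕ → ℕ}
    (hsize : Tendsto (fun n : ℕ => (n : ℝ) / (α n : ℝ)) atTop (𝓝 0)) :
    Tendsto (fun n => (α n : ℝ)⁻¹) atTop (𝓝 0) := by
  refine squeeze_zero' (Eventually.of_forall fun n => by positivity) ?_ hsize
  filter_upwards [eventually_ge_atTop 1] with n hn
  rw [div_eq_mul_inv]
  exact le_mul_of_one_le_left (by positivity) (by exact_mod_cast hn)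

lemma exists_eventually_bound_lt (hpos : ∀ n, 0 < h n)
    (hlong : Tendsto (fun n : ℕ => (n : ℝ≥0) * h n) atTop atTop) {α : ℕ → ℕ}
    (hsize : Tendsto (fun n : ℕ => (n : ℝ) / (α n : ℝ)) atTop (𝓝 0)) {r : ℝ} (hr : 0 < r)
    (C C' : ℝ) {η : ℝ} (hη : 0 < η) :
    ∃ N : ℕ, 0 < N ∧ ∀ᶠ n in atTop,
      2 * √(C * Real.exp (-(r * (truncationLevel h n * h n)))) +
        2 * N * √(((α n : ℝ)⁻¹ + ((n / truncationLevel h n : ℕ) : ℝ)⁻¹) * C') +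
        √C' / N < η := by
  -- The bracket size is made smaller than `η` first; for this fixed `N` the other two terms vanish
  -- as `n` grows.
  obtain ⟨N, hN⟩ := exists_nat_gt (√C' / η)
  have hN0 : 0 < N := by
    have : (0 : ℝ) < N := (div_nonneg (Real.sqrt_nonneg _) hη.le).trans_lt hN
    exact_mod_cast this
  have hN0' : (0 : ℝ) < N := by exact_mod_cast hN0
  refine ⟨N, hN0, ?_⟩
  have h1 : Tendsto (fun n => Real.exp (-(r * (truncationLevel h n * h n)))) atTop (𝓝 0) :=
    Real.tendsto_exp_neg_atTop_nhds_zero.comp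
      ((tendsto_truncationLevel_mul hpos hlong).const_mul_atTop hr)
  have h2 : Tendsto (fun n => ((n / truncationLevel h n : ℕ) : ℝ)⁻¹) atTop (𝓝 0) :=
    tendsto_inv_atTop_zero.comp
      (tendsto_natCast_atTop_atTop.comp (tendsto_div_truncationLevel hpos hlong))
  have h3 := ((h1.const_mul C).sqrt.const_mul 2).add
    ((((tendsto_inv_of_div hsize).add h2).mul_const C').sqrt.const_mul (2 * (N : ℝ)))
  have h4 := h3.add_const (√C' / N)
  refine h4.eventually_lt_const ?_
  simp only [mul_zero, add_zero, zero_mul, Real.sqrt_zero, zero_add]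
  rw [div_lt_iff₀ hN0', mul_comm]
  rwa [div_lt_iff₀ hη] at hN

end Asymptotics

/-! ### Transfer from the product law to the risk process -/

section Assembly

variable {Ω : Type*} [MeasurableSpace Ω] {μ : Measure Ω}
  {u c σ : ℝ} {W S : ℝ≥0 → Ω → ℝ} {ν : Measure ℝ} {X : Ω → CadlagPath}

lemma discountedRise_extendZero (β u : ℝ) {m l n : ℕ} (hl : l ≤ n) (h : ℝ≥0) (x : CadlagPath) :
    discountedRise β u m l (extendZero (increments h n x)) =
      discountedRise β u m l (increment h x) :=
  discountedRise_congr β u fun i hi => by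
    have hin : i < n := by omega
    simp [extendZero, hin, increments]

lemma IsRiskProcess.integral_map_increments (hX : IsRiskProcess μ u c σ W S ν X) {h : ℝ≥0}
    {n : ℕ} {κ : Measure ℝ} (hlaw : μ.map (fun ω => increments h n (X ω)) = Measure.pi fun _ => κ)
    {g : (Fin n → ℝ) → ℝ} (hg : Measurable g) :
    (Integrable (fun x => g (increments h n x)) (μ.map X) ↔
      Integrable g (Measure.pi fun _ => κ)) ∧
    ∫ x, g (increments h n x) ∂(μ.map X) = ∫ y, g y ∂(Measure.pi fun _ => κ) := by
  have hm := measurable_increments h n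
  have hmap : (μ.map X).map (increments h n) = Measure.pi fun _ => κ := by
    rw [Measure.map_map hm hX.measurable]; exact hlaw
  rw [← hmap]
  exact ⟨(integrable_map_measure hg.aestronglyMeasurable hm.aemeasurable).symm,
    (integral_map hm.aemeasurable hg.aestronglyMeasurable).symm⟩

lemma discountedRise_pi_bound {h : ℝ≥0} {n : ℕ} {κ : Measure ℝ} {r K : ℝ} {m l : ℕ} (hl : l ≤ n)
    (hX : Measurable X)
    (hlaw : μ.map (fun ω => increments h n (X ω)) = Measure.pi fun _ => κ)
    (hb : Integrable (fun ω => discountedRise (Real.exp (-(r * h))) u m l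
        (increment h (X ω)) ^ 2) μ ∧
      ∫ ω, discountedRise (Real.exp (-(r * h))) u m l (increment h (X ω)) ^ 2 ∂μ ≤ K) :
    Integrable (fun y => discountedRise (Real.exp (-(r * h))) u m l (extendZero y) ^ 2)
        (Measure.pi fun _ : Fin n => κ) ∧
      ∫ y, discountedRise (Real.exp (-(r * h))) u m l (extendZero y) ^ 2
        ∂(Measure.pi fun _ : Fin n => κ) ≤ K := by
  have hm : Measurable fun ω => increments h n (X ω) := (measurable_increments h n).comp hX
  have hg : Measurable fun y : Fin n → ℝ =>
      discountedRise (Real.exp (-(r * h))) u m l (extendZero y) ^ 2 :=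
    ((measurable_discountedRise _ u m l).comp (measurable_extendZero n)).pow_const 2
  rw [← hlaw, integrable_map_measure hg.aestronglyMeasurable hm.aemeasurable,
    integral_map hm.aemeasurable hg.aestronglyMeasurable]
  simp only [Function.comp_def, discountedRise_extendZero _ u hl]
  exact hb

variable [IsProbabilityMeasure μ]

lemma IsRiskProcess.integrable_discreteValue (hX : IsRiskProcess μ u c σ W S ν X) {r ϑ : ℝ}
    (hr : 0 < r) {h : ℝ≥0} (hh : 0 < h) (n : ℕ) (hϑ : u ≤ ϑ) :
    Integrable (discreteValue r u h n ϑ) (μ.map X) := by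
  obtain ⟨C, -, hC⟩ := hX.exists_discountedRise_bound hr
  obtain ⟨κ, hκ, hlaw⟩ := hX.exists_map_increments h n
  have hfun : discreteValue r u h n ϑ = fun x => walkValue (Real.exp (-(r * h))) u (n - 1) ϑ
      (extendZero (increments h n x)) :=
    funext fun x => discreteValue_eq r hX.initial_nonneg hϑ hh n x
  have hgm : Measurable fun y : Fin n → ℝ =>
      walkValue (Real.exp (-(r * h))) u (n - 1) ϑ (extendZero y) :=
    (measurable_walkValue _ u _ ϑ).comp (measurable_extendZero n)
  rw [hfun, (hX.integral_map_increments hlaw hgm).1]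
  have hb := (discountedRise_pi_bound (n := n) (Nat.sub_le n 1) hX.measurable hlaw
    (hC h 0 (n - 1) (Nat.zero_le _))).1
  have hrm : Measurable fun y : Fin n → ℝ =>
      discountedRise (Real.exp (-(r * h))) u 0 (n - 1) (extendZero y) :=
    (measurable_discountedRise _ u _ _).comp (measurable_extendZero n)
  refine (((memLp_two_iff_integrable_sq hrm.aestronglyMeasurable).2 hb).integrable
    (by norm_num)).mono' hgm.aestronglyMeasurable (ae_of_all _ fun y => ?_)
  rw [Real.norm_of_nonneg (walkValue_nonneg u _ ϑ _ (Real.exp_pos _).le)]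
  exact walkValue_le u _ ϑ _ (Real.exp_pos _).le

/-- For all `0 < m < n`, the uniform deviation is dominated by a random variable with an explicit
bound on its expectation. -/
lemma IsRiskProcess.exists_dominating (hX : IsRiskProcess μ u c σ W S ν X) {r ϑbar : ℝ}
    (hr : 0 < r) (hϑ : u ≤ ϑbar) : ∃ C C' : ℝ, ∀ (h : ℝ≥0) (n a m N : ℕ)
      (π : Fin a → Ω → Equiv.Perm (Fin n)), 0 < h → 0 < a → 0 < m → m < n → 0 < N →
      IsUniformSample μ X π → ∃ R : Ω → ℝ, Integrable R μ ∧ (∀ ω, 0 ≤ R ω) ∧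
      (∀ ω, ∀ ϑ ∈ Set.Icc u ϑbar, |∫ x, discreteValue r u h n ϑ x
            ∂(empiricalMeasure u h n a (fun k => π k ω) (X ω))
          - ∫ x, discreteValue r u h n ϑ x ∂(μ.map X)| ≤ R ω) ∧
      ∫ ω, R ω ∂μ ≤ 2 * √(C * Real.exp (-(r * (m * h)))) +
        2 * N * √(((a : ℝ)⁻¹ + ((n / m : ℕ) : ℝ)⁻¹) * C') + √C' / N := by
  obtain ⟨C, -, hC⟩ := hX.exists_discountedRise_bound hr
  refine ⟨C, 2 * C + 2 * (ϑbar - u) ^ 2, fun h n a m N π hh ha hm hmn hN hπ => ?_⟩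
  obtain ⟨κ, hκ, hlaw⟩ := hX.exists_map_increments h n
  have hVm : Measurable fun ω => increments h n (X ω) :=
    (measurable_increments h n).comp hX.measurable
  have hind : IndepFun (fun ω => increments h n (X ω)) (fun ω k => π k ω) μ :=
    hπ.indep.comp (measurable_increments h n) measurable_id
  have hβ1 : Real.exp (-(r * h)) ≤ 1 :=
    Real.exp_le_one_iff.2 (neg_nonpos.2 (mul_nonneg hr.le h.2))
  have hrise := discountedRise_pi_bound hmn.le hX.measurable hlaw (hC h 0 m (Nat.zero_le _))
  -- The tail ends at `n - 1` since `discreteValue` has no payment at `n h`; hence the requirement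
  -- `m < n`.
  have htail := discountedRise_pi_bound (Nat.sub_le n 1) hX.measurable hlaw
    (hC h m (n - 1) (by omega))
  simp only [Nat.cast_zero, zero_mul, mul_zero, neg_zero, Real.exp_zero, mul_one] at hrise
  obtain ⟨R, hRi, hR0, hR, hRint⟩ := exists_uniform_bound ha hVm hlaw hπ.measurable hπ.uniform
    hπ.iIndep hind hm (by omega : m ≤ n - 1) (Nat.sub_le n 1) (Real.exp_pos _).le hβ1 hϑ
    hrise.1 hrise.2 htail.1 htail.2 hN
  refine ⟨R, hRi, hR0, fun ω ϑ hϑm => ?_, hRint⟩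
  have hgm : Measurable fun y : Fin n → ℝ =>
      walkValue (Real.exp (-(r * h))) u (n - 1) ϑ (extendZero y) :=
    (measurable_walkValue _ u _ ϑ).comp (measurable_extendZero n)
  have hfun : ∀ x, discreteValue r u h n ϑ x = walkValue (Real.exp (-(r * h))) u (n - 1) ϑ
      (extendZero (increments h n x)) := discreteValue_eq r hX.initial_nonneg hϑm.1 hh n
  simp only [hfun]
  rw [integral_empiricalMeasure hh (fun k => π k ω) (X ω) hgm,
    (hX.integral_map_increments hlaw hgm).2]
  exact hR ω ϑ hϑm

end Assembly

end DividendBarrier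

end

/-! ### Convergence in probability -/

open DividendBarrier
theorem lemma3 {Ω : Type*} [MeasurableSpace Ω] (μ : Measure Ω) [IsProbabilityMeasure μ]
    (u c σ r ϑbar : ℝ) (W S : ℝ≥0 → Ω → ℝ) (ν : Measure ℝ) (X : Ω → CadlagPath)
    (hX : IsRiskProcess μ u c σ W S ν X)
    (hr : 0 < r) (hϑ : u < ϑbar)
    (h : ℕ → ℝ≥0) (hpos : ∀ n, 0 < h n)
    (hfreq : Tendsto h atTop (𝓝 0))
    (hlong : Tendsto (fun n : ℕ => (n : ℝ≥0) * h n) atTop atTop)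
    (α : ℕ → ℕ) (hα : ∀ n, 0 < α n)
    (hsize : Tendsto (fun n : ℕ => (n : ℝ) / (α n : ℝ)) atTop (𝓝 0))
    (π : ∀ n, Fin (α n) → Ω → Equiv.Perm (Fin n))
    (hπ : ∀ n, IsUniformSample μ X (π n)) :
    (∀ n, ∀ ϑ ∈ Set.Icc u ϑbar, Integrable (discreteValue r u (h n) n ϑ) (μ.map X)) ∧
    TendstoInMeasure μ
      (fun n ω => ⨆ ϑ ∈ Set.Icc u ϑbar, ENNReal.ofReal
        |∫ x, discreteValue r u (h n) n ϑ x
            ∂(empiricalMeasure u (h n) n (α n) (fun k => π n k ω) (X ω))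
          - ∫ x, discreteValue r u (h n) n ϑ x ∂(μ.map X)|)
      atTop (fun _ => (0 : ℝ≥0∞)) := by
  refine ⟨fun n ϑ hϑm => hX.integrable_discreteValue hr (hpos n) n hϑm.1, fun ε hε => ?_⟩
  obtain ⟨C, C', hdom⟩ := hX.exists_dominating hr hϑ.le
  rw [ENNReal.tendsto_atTop_zero]
  intro δ hδ
  -- Capping at `1` replaces possibly infinite `ε` and `δ` by positive reals `e` and `d`; Markov's
  -- inequality then needs a mean below `e * d`.
  have hfin : ∀ x : ℝ≥0∞, min x 1 ≠ ∞ := fun x =>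
    ((min_le_right x 1).trans_lt ENNReal.one_lt_top).ne
  have hrpos : ∀ x : ℝ≥0∞, 0 < x → 0 < (min x 1).toReal := fun x hx =>
    ENNReal.toReal_pos (lt_min hx one_pos).ne' (hfin x)
  set e : ℝ := (min ε 1).toReal
  set d : ℝ := (min δ 1).toReal
  have he : 0 < e := hrpos ε hε
  have hd : 0 < d := hrpos δ hδ
  obtain ⟨N, hN, hev⟩ := exists_eventually_bound_lt hpos hlong hsize hr C C' (mul_pos he hd)
  have hev2 := (tendsto_div_truncationLevel hpos hlong).eventually_ge_atTop 2
  obtain ⟨n₀, hn₀⟩ := eventually_atTop.1 ((hev.and hev2).and (eventually_gt_atTop 0))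
  refine ⟨n₀, fun n hn => ?_⟩
  obtain ⟨⟨hb, h2⟩, hn0⟩ := hn₀ n hn
  have hm := truncationLevel_pos hpos hn0
  have hmn : truncationLevel h n < n := by
    rw [Nat.le_div_iff_mul_le hm] at h2
    omega
  obtain ⟨R, hRi, hR0, hR, hRint⟩ := hdom (h n) n (α n) (truncationLevel h n) N (π n) (hpos n)
    (hα n) hm hmn hN (hπ n)
  -- Domination by the integrable `R` holds for every `ω`, so measurability of the uncountable
  -- supremum is not needed.
  have hsub : {ω | ε ≤ edist (⨆ ϑ ∈ Set.Icc u ϑbar, ENNReal.ofReal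
        |∫ x, discreteValue r u (h n) n ϑ x
            ∂(empiricalMeasure u (h n) n (α n) (fun k => π n k ω) (X ω))
          - ∫ x, discreteValue r u (h n) n ϑ x ∂(μ.map X)|) 0} ⊆ {ω | e ≤ R ω} := by
    intro ω hω
    have h1 : ε ≤ ENNReal.ofReal (R ω) := by
      refine le_trans (le_of_le_of_eq hω (edist_ennreal_zero _)) ?_
      exact iSup₂_le fun ϑ hϑm => ENNReal.ofReal_le_ofReal (hR ω ϑ hϑm)
    exact (ENNReal.le_ofReal_iff_toReal_le (hfin ε) (hR0 ω)).1 ((min_le_left _ _).trans h1)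
  have hmarkov := mul_meas_ge_le_integral_of_nonneg (ae_of_all μ hR0) hRi e
  have hreal : μ.real {ω | e ≤ R ω} ≤ d := by
    have : e * μ.real {ω | e ≤ R ω} ≤ e * d := hmarkov.trans (hRint.trans hb.le)
    exact le_of_mul_le_mul_left this he
  refine (measure_mono hsub).trans ?_
  refine le_trans ?_ (min_le_left δ 1)
  exact (ENNReal.toReal_le_toReal (measure_ne_top _ _) (hfin δ)).1 hreal
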